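/- Let $k$ be an algebraically closed field of characteristic $2$. Let $x=X_1/X_0$, $y=X_2/X_0$ be the affine coordinates belonging to the homogeneous coordinates $X_0,X_1,X_2$ of the projective plane $\mathbb{P}^2$ over $k$, with function field $K=k(x,y)$. A *$1$-foliation* of $\mathbb{P}^2$ is a saturated $\mathcal{O}$-submodule sheaf $L$ of the tangent sheaf $T_{\mathbb{P}^2}$ which is closed under Lie brackets and $2$-closed, i.e. $\delta^2=\delta\circ\delta\in L$ for every local section $\delta$ of $L$. It is *invertible* if it is an invertible sheaf, and then $\deg L=n$ means $L\cong\mathcal{O}_{\mathbb{P}^2}(n)$. A rational vector field $\delta_0\in\operatorname{Der}_k K$ is *$2$-closed* if $\delta_0^2=f\delta_0$ for some $f\in K$; two rational vector fields $\delta_0,\delta$ are *equivalent* if $\delta_0=\alpha\delta$ for some $\alpha\in K\setminus\{0\}$; and a non-zero $2$-closed rational vector field $\delta_0$ *corresponds* to the invertible $1$-foliation $L$ if locally $\delta_0=\alpha e$ with $\alpha\in K\setminus\{0\}$ and $e$ a local generator of $L$. **Lemma.** Let $L$ be an invertible $1$-foliation of $\mathbb{P}^2$ with $\deg L\ge -1$,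 and let $\delta_0$ be a non-zero $2$-closed rational vector field corresponding to $L$. Then, after a suitable linear change of the homogeneous coordinates of $\mathbb{P}^2$ (an element of $\mathrm{GL}_3(k)$; the new affine coordinates are again denoted by $x,y$), $\delta_0$ is equivalent to a rational vector field $\delta=F\,\partial_x+G\,\partial_y$ such that 1. $F=a_{30}x^3+a_{12}xy^2+a_{20}x^2+a_{02}y^2+a_{10}x$ and $G=a_{30}x^2y+a_{12}y^3+b_{20}x^2+b_{02}y^2+a_{10}y$ for some $a_{30},a_{12},a_{20},a_{02},a_{10},b_{20},b_{02}\in k$; 2. $F\neq 0$ and $G\neq 0$; 3. $F$ and $G$ have no common factors in $k[x,y]$. -/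

import Mathlib

open MvPolynomial TopologicalSpace

noncomputable section

namespace PlaneFoliation

universe u

section Plane

variable (k : Type u) [Field k]

/-- The (closed points of the) projective plane `ℙ²` over `k`, with homogeneous coordinates
`X₀, X₁, X₂`. -/
def Plane : Type u := Projectivization k (Fin 3 → k)

variable {k}

/-- A non-zero vector of homogeneous coordinates of a point. -/
def Plane.coords (P : Plane k) : Fin 3 → k := Projectivization.rep P

/-- The Zariski topology on `ℙ²`, generated by the sets `D₊(f)` with `f` homogeneous. -/
instance : TopologicalSpace (Plane k) :=
  generateFrom {U | ∃ (d : ℕ) (f : MvPolynomial (Fin 3) k), f.IsHomogeneous d ∧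
    U = {P | eval P.coords f ≠ 0}}

variable (k)

/-- The non-empty Zariski open subsets of `ℙ²`. -/
abbrev NOpens : Type u := {U : Opens (Plane k) // U ≠ ⊥}

/-- The function field `K(ℙ²) = k(x, y)`, where `x = X₁ / X₀` and `y = X₂ / X₀`. -/
abbrev FnField : Type u := FractionRing (MvPolynomial (Fin 2) k)

/-- The rational vector fields, `Der_k K(ℙ²)`. -/
abbrev RatVF : Type u := Derivation k (FnField k) (FnField k)

/-- The homogeneous coordinates `(X₀, X₁, X₂)` divided by `X₀`, that is, `(1, x, y)`. Thus
`hom k i / hom k j` is the rational function `X_i / X_j`, and for `A, B` homogeneous of the same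
degree with `B ≠ 0` the rational function `A / B` is the quotient of the values of `A` and `B`
at `hom k`. -/
def hom : Fin 3 → FnField k :=
  ![1, algebraMap (MvPolynomial (Fin 2) k) (FnField k) (X 0),
    algebraMap (MvPolynomial (Fin 2) k) (FnField k) (X 1)]

variable {k}

/-- The local ring `𝒪_P ⊆ K(ℙ²)`: the rational functions `A / B` with `A, B` homogeneous of the
same degree and `B(P) ≠ 0`. -/
def localRing (P : Plane k) : Subalgebra k (FnField k) where
  carrier := {f | ∃ (d : ℕ) (A B : MvPolynomial (Fin 3) k), A.IsHomogeneous d ∧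
    B.IsHomogeneous d ∧ eval P.coords B ≠ 0 ∧ f * aeval (hom k) B = aeval (hom k) A}
  mul_mem' := by
    rintro f g ⟨d, A, B, hA, hB, hP, hf⟩ ⟨e, A', B', hA', hB', hP', hg⟩
    refine ⟨d + e, A * A', B * B', hA.mul hA', hB.mul hB', ?_, ?_⟩
    · simpa using And.intro hP hP'
    · rw [map_mul, map_mul, ← hf, ← hg]; ring
  add_mem' := by
    rintro f g ⟨d, A, B, hA, hB, hP, hf⟩ ⟨e, A', B', hA', hB', hP', hg⟩
    refine ⟨d + e, A * B' + B * A', B * B', (hA.mul hB').add (hB.mul hA'), hB.mul hB', ?_, ?_⟩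
    · simpa using And.intro hP hP'
    · rw [map_mul, map_add, map_mul, map_mul, ← hf, ← hg]; ring
  algebraMap_mem' := by
    intro c
    exact ⟨0, C c, 1, isHomogeneous_C _ _, isHomogeneous_one _ _, by simp, by simp⟩

/-- The ring `𝒪(U)` of regular functions on a non-empty open set `U`, as a subring of the
function field. -/
def regular (U : NOpens k) : Subalgebra k (FnField k) := ⨅ P ∈ U.1, localRing P

/-- The sections over `U` of the tangent sheaf `T` of `ℙ²`, that is, of the sheaf of
`k`-derivations of `𝒪`: the rational vector fields that map `𝒪_P` into itself for all `P ∈ U`. -/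
def tangent (U : NOpens k) : Submodule (regular U) (RatVF k) where
  carrier := {D | ∀ P ∈ U.1, ∀ f ∈ localRing P, D f ∈ localRing P}
  add_mem' := fun h₁ h₂ P hP f hf => add_mem (h₁ P hP f hf) (h₂ P hP f hf)
  zero_mem' := fun P _ _ _ => zero_mem (localRing P)
  smul_mem' := by
    intro c D h P hP f hf
    have hc : (c : FnField k) ∈ localRing P := by
      have := c.2
      simp only [regular, Algebra.mem_iInf] at this
      exact this P hP
    exact mul_mem hc (h P hP f hf)

end Plane

/-- A `1`-foliation of `ℙ²` in characteristic `p`: a saturated `p`-closed `𝒪`-submodule sheaf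
`L ⊆ T` closed under Lie brackets. Since `T` is a subsheaf of the constant sheaf `Der_k K(ℙ²)`,
the restriction maps are inclusions, and so the gluing of sections over a cover (any two members
of which meet) is an intersection. -/
structure Foliation (k : Type u) [Field k] (p : ℕ) where
  /-- The sections `L(U)`. -/
  sections : (U : NOpens k) → Submodule (regular U) (RatVF k)
  le_tangent : ∀ U, sections U ≤ tangent U
  restrict : ∀ U V : NOpens k, V ≤ U → ∀ D ∈ sections U, D ∈ sections V
  glue : ∀ (U : NOpens k) (𝒱 : Set (NOpens k)), (∀ V ∈ 𝒱, V ≤ U) →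
    (∀ P ∈ U.1, ∃ V ∈ 𝒱, P ∈ V.1) → ∀ D : RatVF k, (∀ V ∈ 𝒱, D ∈ sections V) → D ∈ sections U
  /-- `T / L` is torsion-free. -/
  saturated : ∀ (U : NOpens k), ∀ D ∈ tangent U, ∀ f : regular U, f ≠ 0 →
    f • D ∈ sections U → D ∈ sections U
  /-- The `p`-fold composite of a section is a section. -/
  pow_closed : ∀ (U : NOpens k), ∀ D ∈ sections U, ∃ E ∈ sections U, ∀ f, E f = (⇑D)^[p] f
  lie_closed : ∀ (U : NOpens k), ∀ D ∈ sections U, ∀ E ∈ sections U, ⁅D, E⁆ ∈ sections U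

section Notions

variable {k : Type u} [Field k] {p : ℕ}

/-- `e` is a basis of `L|_U`: for every `V ⊆ U`, multiplication `f ↦ f e` is a bijection from
`𝒪(V)` onto `L(V)` (it is injective because `e ≠ 0` and `Der_k K(ℙ²)` is a `K(ℙ²)`-vector
space). -/
def Foliation.IsGenerator (L : Foliation k p) (U : NOpens k) (e : RatVF k) : Prop :=
  e ≠ 0 ∧ ∀ V : NOpens k, V ≤ U → ∀ D : RatVF k,
    D ∈ L.sections V ↔ ∃ f ∈ regular V, D = f • e

/-- `L` is an invertible sheaf. -/
def Foliation.IsInvertible (L : Foliation k p) : Prop :=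
  ∀ P : Plane k, ∃ U : NOpens k, P ∈ U.1 ∧ ∃ e, L.IsGenerator U e

/-- `deg L = n`, that is, `L ≅ 𝒪(n)`: on the sets `U_i = D₊(X_i)` the sheaf `L` has generators
`e_i` with the same transition functions as the generators `X_i ^ n` of `𝒪(n)`. -/
def Foliation.HasDegree (L : Foliation k p) (n : ℤ) : Prop :=
  ∃ e : Fin 3 → RatVF k,
    (∀ (i : Fin 3) (U : NOpens k), (U.1 : Set (Plane k)) = {P | P.coords i ≠ 0} →
      L.IsGenerator U (e i)) ∧
    ∀ i j : Fin 3, e i = (hom k i / hom k j) ^ n • e j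

/-- `δ ^ p = f δ` for some rational function `f`. -/
def IsPClosed (p : ℕ) (δ : RatVF k) : Prop :=
  ∃ f : FnField k, ∀ h, (⇑δ)^[p] h = f * δ h

/-- `δ = α δ'` for some non-zero rational function `α`. -/
def Equivalent (δ δ' : RatVF k) : Prop := ∃ α : FnField k, α ≠ 0 ∧ δ = α • δ'

/-- The rational vector field `δ` corresponds to `L`: locally `δ = α e`, where `α ≠ 0` is a
rational function and `e` is a generator of `L`; in other words multiplication by `δ` is an
isomorphism from `𝒪(div δ)`, `div δ` being locally the divisor of `α`, onto `L ⊆ T`.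
(As `L` is saturated, the coefficients of `e` in local coordinates have no common factors.) -/
def Foliation.Corresponds (L : Foliation k p) (δ : RatVF k) : Prop :=
  ∀ P : Plane k, ∃ U : NOpens k, P ∈ U.1 ∧ ∃ (α : FnField k) (e : RatVF k),
    α ≠ 0 ∧ L.IsGenerator U e ∧ δ = α • e

/-- The linear forms `X'_i = ∑ j, g i j X_j`, divided by `X₀`. -/
def newHom (g : GL (Fin 3) k) (i : Fin 3) : FnField k :=
  ∑ j, algebraMap k (FnField k) (g.1 i j) * hom k j

/-- The affine coordinates `x' = X'₁ / X'₀` and `y' = X'₂ / X'₀` belonging to the homogeneous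
coordinates `X' = g X` of `ℙ²`. -/
def affineCoords (g : GL (Fin 3) k) : Fin 2 → FnField k :=
  ![newHom g 1 / newHom g 0, newHom g 2 / newHom g 0]

/-- `δ = F(s 0, s 1) ∂_{s 0} + G(s 0, s 1) ∂_{s 1}`. When `s 0, s 1` generate the function field,
a `k`-derivation is determined by its values at `s 0` and `s 1`. -/
def HasCoefficients (δ : RatVF k) (s : Fin 2 → FnField k) (F G : MvPolynomial (Fin 2) k) : Prop :=
  δ (s 0) = aeval s F ∧ δ (s 1) = aeval s G

end Notions

end PlaneFoliation

end

noncomputable section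

namespace PlaneFoliation

universe u

variable {k : Type u} [Field k]

/-! On the chart `X₀ ≠ 0` the sheaf is generated by a field `F ∂_x + G ∂_y` with polynomial
coefficients, coprime by saturation. Its square is `f` times itself for a polynomial `f`. Hence `F`
divides `F_y G`, so it divides `F_y`, and `F_y = 0` by degree; likewise `G_x = 0`, and then `F_x =
G_y` (`pderiv_relations`). Comparison with the generator on `X₁ ≠ 0` bounds the degrees of `F` and
`xG - yF` by `3`, and by `2` if `n ≥ 0` (`totalDegree_le_of_transition`).

In characteristic `2` this leaves `F = x q₀ + q₁` and `G = y q₀ + q₂` with each `qᵢ` a combination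
of `1, x², y²`. Thus the field is induced by `∑ qᵢ ∂_{Xᵢ}` for a Frobenius-linear map `q` of `k³`
with matrix `M` (`exists_frobForm`). A coordinate change `g` turns `M` into `g M (g⁻¹)⁽²⁾`, the last
factor having squared entries.

For `n = -1`, an eigenvector of `q` (`exists_frobenius_eigenvector`) is made the first basis vector,
which kills the constant terms of the new `F` and `G`. The rescaled field generates `L` on the new
chart, so the coefficients are again coprime; as both vanish at the origin, neither is zero. For `n
≥ 0` the map `q` is a constant vector; with it as first basis vector the field is equivalent to `x
∂_x + y ∂_y`. -/

/-! ### Homogenization and linear changes of coordinates -/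

theorem aeval_smul_of_isHomogeneous {σ K : Type*} [Field K] [Algebra k K] {N : ℕ}
    {A : MvPolynomial σ k} (hA : A.IsHomogeneous N) (c : K) (s : σ → K) :
    aeval (fun i => c * s i) A = c ^ N * aeval s A := by
  rw [aeval_def, aeval_def, eval₂_eq, eval₂_eq, Finset.mul_sum]
  refine Finset.sum_congr rfl fun m hm => ?_
  simp only [mul_pow, Finset.prod_mul_distrib, Finset.prod_pow_eq_pow_sum]
  rw [← hA.degree_eq_sum_deg_support hm]
  ring

theorem aeval_self_eq_eval {σ : Type*} (p : σ → k) (A : MvPolynomial σ k) :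
    aeval p A = eval p A := by
  rw [← coe_aeval_eq_eval]; rfl

/-- Every polynomial in two variables can be homogenized. -/
theorem exists_homogenization (a : MvPolynomial (Fin 2) k) :
    ∃ (N : ℕ) (A : MvPolynomial (Fin 3) k), A.IsHomogeneous N ∧
      ∀ (K : Type u) [Field K] [Algebra k K] (s : Fin 3 → K), s 0 ≠ 0 →
        aeval s A = s 0 ^ N * aeval ![s 1 / s 0, s 2 / s 0] a := by
  -- `N` need not be the degree of `a`. One `A` serves all fields `K`, so it can be evaluated both
  -- at points over `k` and at the coordinates in the function field.
  induction a using MvPolynomial.induction_on with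
  | C c => exact ⟨0, C c, isHomogeneous_C _ _, fun K _ _ s _ => by simp⟩
  | add p q hp hq =>
    obtain ⟨N, A, hA, hA'⟩ := hp
    obtain ⟨M, B, hB, hB'⟩ := hq
    refine ⟨N + M, A * X 0 ^ M + X 0 ^ N * B, ?_, fun K _ _ s hs => ?_⟩
    · exact (hA.mul (isHomogeneous_X_pow 0 M)).add ((isHomogeneous_X_pow 0 N).mul hB)
    · simp only [map_add, map_mul, map_pow, aeval_X, hA' K s hs, hB' K s hs]
      ring
  | mul_X p i hp =>
    obtain ⟨N, A, hA, hA'⟩ := hp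
    refine ⟨N + 1, A * X i.succ, hA.mul (isHomogeneous_X k _), fun K _ _ s hs => ?_⟩
    simp only [map_mul, aeval_X, hA' K s hs]
    fin_cases i <;> · simp; field_simp; ring

/-- The linear change of variables `X ↦ g X`. -/
def linSubst (g : GL (Fin 3) k) : MvPolynomial (Fin 3) k →ₐ[k] MvPolynomial (Fin 3) k :=
  aeval fun i => ∑ j, C (g.1 i j) * X j

theorem isHomogeneous_linSubst (g : GL (Fin 3) k) {N : ℕ} {A : MvPolynomial (Fin 3) k}
    (hA : A.IsHomogeneous N) : (linSubst g A).IsHomogeneous N := by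
  have := hA.aeval (fun i => ∑ j, C (g.1 i j) * X j) (n := 1) fun i =>
    IsHomogeneous.sum _ _ _ fun j _ => isHomogeneous_C_mul_X _ _
  rwa [one_mul] at this

theorem aeval_linSubst (g : GL (Fin 3) k) {K : Type*} [Field K] [Algebra k K]
    (s : Fin 3 → K) (A : MvPolynomial (Fin 3) k) :
    aeval s (linSubst g A) = aeval (fun i => ∑ j, algebraMap k K (g.1 i j) * s j) A := by
  rw [linSubst, ← AlgHom.comp_apply, comp_aeval]
  simp

theorem aeval_hom_linSubst (g : GL (Fin 3) k) (A : MvPolynomial (Fin 3) k) :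
    aeval (hom k) (linSubst g A) = aeval (newHom g) A :=
  aeval_linSubst g (hom k) A

/-- The coordinates of a point in the new homogeneous coordinates. -/
def newCoords (g : GL (Fin 3) k) (P : Plane k) (i : Fin 3) : k := ∑ j, g.1 i j * P.coords j

theorem eval_coords_linSubst (g : GL (Fin 3) k) (P : Plane k) (A : MvPolynomial (Fin 3) k) :
    eval P.coords (linSubst g A) = eval (newCoords g P) A := by
  have := aeval_linSubst g P.coords A
  rw [aeval_self_eq_eval, aeval_self_eq_eval] at this
  exact this

theorem sum_inv_mul (g : GL (Fin 3) k) {K : Type*} [Field K] [Algebra k K] (s : Fin 3 → K)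
    (i : Fin 3) :
    ∑ j, algebraMap k K ((g⁻¹).1 i j) * ∑ l, algebraMap k K (g.1 j l) * s l = s i := by
  have h : (g⁻¹).1 * g.1 = 1 := by rw [← Units.val_mul]; simp
  have h2 : ((g⁻¹).1.map (algebraMap k K)) * (g.1.map (algebraMap k K)) = 1 := by
    rw [← Matrix.map_mul, h, Matrix.map_one _ (map_zero _) (map_one _)]
  have h3 := congrFun (congrArg (fun M => M.mulVec s) h2) i
  simp only [← Matrix.mulVec_mulVec, Matrix.one_mulVec] at h3
  exact h3

theorem sum_inv_newHom (g : GL (Fin 3) k) (i : Fin 3) :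
    ∑ j, algebraMap k (FnField k) ((g⁻¹).1 i j) * newHom g j = hom k i :=
  sum_inv_mul g (hom k) i

theorem sum_inv_newCoords (g : GL (Fin 3) k) (P : Plane k) (i : Fin 3) :
    ∑ j, (g⁻¹).1 i j * newCoords g P j = P.coords i :=
  sum_inv_mul g P.coords i

theorem coords_ne_zero (P : Plane k) : P.coords ≠ 0 := Projectivization.rep_nonzero P

/-- Every non-zero vector is a system of new coordinates of some point. The scalar `c` appears
because `coords` is a fixed representative. -/
theorem exists_newCoords (g : GL (Fin 3) k) (w : Fin 3 → k) (hw : w ≠ 0) :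
    ∃ (P : Plane k) (c : k), c ≠ 0 ∧ ∀ i, newCoords g P i = c * w i := by
  set v : Fin 3 → k := fun i => ∑ j, (g⁻¹).1 i j * w j with hv
  have hgv : ∀ i, ∑ j, g.1 i j * v j = w i := fun i => by
    have := sum_inv_mul g⁻¹ w i
    rw [inv_inv] at this
    exact this
  have hv0 : v ≠ 0 := by
    rintro h
    refine hw (funext fun i => ?_)
    rw [← hgv i, h]; simp
  obtain ⟨c, hc⟩ := Projectivization.exists_smul_eq_mk_rep k v hv0
  refine ⟨Projectivization.mk k v hv0, c, c.ne_zero, fun i => ?_⟩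
  have : Plane.coords (Projectivization.mk k v hv0) = fun i => (c : k) * v i := by
    exact hc.symm
  simp only [newCoords, this, ← hgv i, Finset.mul_sum]
  exact Finset.sum_congr rfl fun j _ => by ring

/-! ### Affine charts and their local rings -/

/-- The affine chart `X'₀ ≠ 0`. -/
def chart (g : GL (Fin 3) k) : NOpens k :=
  ⟨⟨{P | newCoords g P 0 ≠ 0}, isOpen_generateFrom_of_mem
    ⟨1, linSubst g (X 0), isHomogeneous_linSubst g (isHomogeneous_X k 0), by
      ext P; simp [eval_coords_linSubst]⟩⟩, by
    intro h
    obtain ⟨P, c, hc, hP⟩ := exists_newCoords g ![1, 0, 0] (fun h => by simpa using congrFun h 0)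
    have : P ∈ (⊥ : Opens (Plane k)) := by
      rw [← h]
      change newCoords g P 0 ≠ 0
      rw [hP]; simpa using hc
    exact this⟩

theorem mem_chart {g : GL (Fin 3) k} {P : Plane k} : P ∈ (chart g).1 ↔ newCoords g P 0 ≠ 0 :=
  Iff.rfl

/-- The affine coordinates of a point of the chart `X'₀ ≠ 0`. -/
def pt (g : GL (Fin 3) k) (P : Plane k) : Fin 2 → k :=
  ![newCoords g P 1 / newCoords g P 0, newCoords g P 2 / newCoords g P 0]

theorem exists_pt (g : GL (Fin 3) k) (p : Fin 2 → k) : ∃ P ∈ (chart g).1, pt g P = p := by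
  obtain ⟨P, c, hc, hP⟩ := exists_newCoords g ![1, p 0, p 1] (fun h => by simpa using congrFun h 0)
  refine ⟨P, ?_, ?_⟩
  · rw [mem_chart, hP]; simpa using hc
  · ext i
    fin_cases i <;> simp [pt, hP, hc]

theorem algebraMap_injective_fn :
    Function.Injective (algebraMap (MvPolynomial (Fin 2) k) (FnField k)) :=
  IsFractionRing.injective _ _

/-- `newHom g i` as a polynomial in `x, y`. -/
def newHomPoly (g : GL (Fin 3) k) (i : Fin 3) : MvPolynomial (Fin 2) k :=
  C (g.1 i 0) + C (g.1 i 1) * X 0 + C (g.1 i 2) * X 1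

theorem algebraMap_newHomPoly (g : GL (Fin 3) k) (i : Fin 3) :
    algebraMap _ (FnField k) (newHomPoly g i) = newHom g i := by
  have h : ∀ c : k, algebraMap (MvPolynomial (Fin 2) k) (FnField k) (C c) =
      algebraMap k (FnField k) c := fun c => (IsScalarTower.algebraMap_apply k _ _ c).symm
  simp [newHomPoly, newHom, hom, Fin.sum_univ_three, h]

/-- A linear form vanishing at `(1,0,0)`, `(1,1,0)` and `(1,0,1)` has zero coefficients, which no
row of an invertible matrix has. -/
theorem newHomPoly_ne_zero (g : GL (Fin 3) k) (i : Fin 3) : newHomPoly g i ≠ 0 := by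
  intro h
  have hv : ∀ v : Fin 3 → k, v 0 = 1 → ∑ j, g.1 i j * v j = 0 := by
    intro v hv
    have := congrArg (eval ![v 1, v 2]) h
    simpa [newHomPoly, Fin.sum_univ_three, hv] using this
  have h0 := hv ![1, 0, 0] rfl
  have h1 := hv ![1, 1, 0] rfl
  have h2 := hv ![1, 0, 1] rfl
  simp only [Fin.sum_univ_three, Matrix.cons_val_zero, Matrix.cons_val_one, Matrix.cons_val] at h0 h1 h2
  have hrow : ∀ j, g.1 i j = 0 := by
    intro j
    fin_cases j
    · simpa using h0
    · simp only [mul_one, mul_zero, add_zero] at h0 h1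
      simpa [h0] using h1
    · simp only [mul_one, mul_zero, add_zero] at h0 h2
      simpa [h0] using h2
  have := congrFun (congrFun (show g.1 * (g⁻¹).1 = 1 by rw [← Units.val_mul]; simp) i) i
  simp [Matrix.mul_apply, hrow] at this

theorem newHom_ne_zero (g : GL (Fin 3) k) (i : Fin 3) : newHom g i ≠ 0 := by
  rw [← algebraMap_newHomPoly, Ne, map_eq_zero_iff _ algebraMap_injective_fn]
  exact newHomPoly_ne_zero g i

/-- The local ring of a point of a chart in terms of the affine coordinates of the chart. -/
theorem mem_localRing_iff (g : GL (Fin 3) k) {P : Plane k} (hP : P ∈ (chart g).1) (f : FnField k) :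
    f ∈ localRing P ↔ ∃ a b : MvPolynomial (Fin 2) k, eval (pt g P) b ≠ 0 ∧
      f * aeval (affineCoords g) b = aeval (affineCoords g) a := by
  have hw := mem_chart.1 hP
  have hh := newHom_ne_zero g 0
  constructor
  · rintro ⟨d, A, B, hA, hB, hBP, hf⟩
    -- Dehomogenization: the old coordinates are written in the new ones by `g⁻¹`, with `X'₀` set to
    -- `1`.
    let r : MvPolynomial (Fin 3) k →ₐ[k] MvPolynomial (Fin 2) k :=
      aeval fun i => ∑ j, C ((g⁻¹).1 i j) * ![1, X 0, X 1] j
    have h1 : ∀ {A : MvPolynomial (Fin 3) k}, A.IsHomogeneous d →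
        aeval (affineCoords g) (r A) = (newHom g 0)⁻¹ ^ d * aeval (hom k) A := by
      intro A hA
      rw [← aeval_smul_of_isHomogeneous hA, ← AlgHom.comp_apply, comp_aeval]
      congr 2
      funext i
      rw [← sum_inv_newHom g i, Finset.mul_sum]
      simp only [map_sum, map_mul, algHom_C]
      refine Finset.sum_congr rfl fun j _ => ?_
      fin_cases j <;> simp [affineCoords] <;> field_simp
    have h2 : eval (pt g P) (r B) = (newCoords g P 0)⁻¹ ^ d * eval P.coords B := by
      have := aeval_smul_of_isHomogeneous hB (newCoords g P 0)⁻¹ P.coords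
      rw [← aeval_self_eq_eval, ← aeval_self_eq_eval]
      rw [← this, ← AlgHom.comp_apply, comp_aeval]
      congr 2
      funext i
      rw [← sum_inv_newCoords g P i, Finset.mul_sum]
      simp only [map_sum, map_mul, algHom_C]
      refine Finset.sum_congr rfl fun j _ => ?_
      fin_cases j <;> simp [pt] <;> field_simp
    refine ⟨r A, r B, ?_, ?_⟩
    · rw [h2]
      exact mul_ne_zero (pow_ne_zero _ (inv_ne_zero hw)) hBP
    · rw [h1 hA, h1 hB, ← hf]; ring
  · rintro ⟨a, b, hb, hf⟩
    obtain ⟨N, A, hA, hA'⟩ := exists_homogenization a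
    obtain ⟨M, B, hB, hB'⟩ := exists_homogenization b
    -- Powers of `X'₀`, a unit at `P`, bring numerator and denominator to the same degree.
    refine ⟨N + M, linSubst g (A * X 0 ^ M), linSubst g (X 0 ^ N * B),
      isHomogeneous_linSubst g (hA.mul (isHomogeneous_X_pow 0 M)),
      isHomogeneous_linSubst g ((isHomogeneous_X_pow 0 N).mul hB), ?_, ?_⟩
    · rw [eval_coords_linSubst, map_mul, map_pow, eval_X]
      refine mul_ne_zero (pow_ne_zero _ hw) ?_
      have := hB' k (newCoords g P) hw
      rw [aeval_self_eq_eval, aeval_self_eq_eval] at this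
      rw [this]
      exact mul_ne_zero (pow_ne_zero _ hw) hb
    · rw [aeval_hom_linSubst, aeval_hom_linSubst, map_mul, map_mul, map_pow, map_pow, aeval_X,
        hA' _ _ hh, hB' _ _ hh]
      change _ * (_ * (_ * aeval (affineCoords g) b)) = _ * aeval (affineCoords g) a * _
      rw [← hf]; ring

/-- A relation `a(x', y') = 0` homogenizes to a polynomial identity, which can be evaluated at
points. So `a` vanishes wherever `X₀ X'₀ ≠ 0`, and density does the rest. -/
theorem aeval_affineCoords_injective [Infinite k] (g : GL (Fin 3) k) :
    Function.Injective (aeval (R := k) (affineCoords g)) := by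
  rw [injective_iff_map_eq_zero]
  intro a ha
  obtain ⟨N, A, hA, hA'⟩ := exists_homogenization a
  have h1 : aeval (newHom g) A = 0 := by
    rw [hA' _ _ (newHom_ne_zero g 0)]
    change _ * aeval (affineCoords g) a = 0
    rw [ha, mul_zero]
  have h2 : aeval (newHomPoly g) A = 0 := by
    apply algebraMap_injective_fn
    rw [map_zero, ← h1, ← MvPolynomial.aeval_algebraMap_apply]
    congr 2
    funext i
    exact algebraMap_newHomPoly g i
  -- `ℓ` is `X₀ / X'₀` in the new coordinates; its zeros are the points of the chart that the old
  -- chart misses.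
  let ℓ : MvPolynomial (Fin 2) k :=
    C ((g⁻¹).1 0 0) + C ((g⁻¹).1 0 1) * X 0 + C ((g⁻¹).1 0 2) * X 1
  have h3 : ℓ * a = 0 := by
    apply MvPolynomial.funext
    intro p
    obtain ⟨P, hP, rfl⟩ := exists_pt g p
    have hw := mem_chart.1 hP
    have e1 : eval (newCoords g P) A = newCoords g P 0 ^ N * eval (pt g P) a := by
      have := hA' k (newCoords g P) hw
      rwa [aeval_self_eq_eval, aeval_self_eq_eval] at this
    have e2 : P.coords 0 = newCoords g P 0 * eval (pt g P) ℓ := by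
      rw [← sum_inv_newCoords g P 0, Fin.sum_univ_three]
      simp only [ℓ, pt, map_add, map_mul, eval_C, eval_X, Matrix.cons_val_zero, Matrix.cons_val_one]
      field_simp
    rw [map_mul, map_zero, mul_eq_zero, or_iff_not_imp_left]
    intro hl
    have hc : P.coords 0 ≠ 0 := by rw [e2]; exact mul_ne_zero hw hl
    have e3 := congrArg (eval ![P.coords 1 / P.coords 0, P.coords 2 / P.coords 0]) h2
    rw [map_zero, ← aeval_self_eq_eval, ← AlgHom.comp_apply, comp_aeval] at e3
    have e4 : (fun i => aeval ![P.coords 1 / P.coords 0, P.coords 2 / P.coords 0]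
        (newHomPoly g i)) = fun i => (P.coords 0)⁻¹ * newCoords g P i := by
      funext i
      simp only [newHomPoly, newCoords, Fin.sum_univ_three, map_add, map_mul, algHom_C, aeval_X,
        Matrix.cons_val_zero, Matrix.cons_val_one, Algebra.algebraMap_self, RingHom.id_apply]
      field_simp
    rw [e4, aeval_smul_of_isHomogeneous hA, aeval_self_eq_eval, e1] at e3
    simpa [hc, hw] using e3
  have hl : ℓ ≠ 0 := newHomPoly_ne_zero g⁻¹ 0
  exact (mul_eq_zero.1 h3).resolve_left hl

/-! ### Regular functions and vector fields on a chart -/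

/-- By the Nullstellensatz, a principal ideal without zeros is the unit ideal. -/
theorem exists_eval_eq_zero_of_not_isUnit [IsAlgClosed k] {b : MvPolynomial (Fin 2) k}
    (hb : ¬ IsUnit b) : ∃ p, eval p b = 0 := by
  by_contra! h
  have h1 := vanishingIdeal_zeroLocus_eq_radical (K := k) (Ideal.span {b})
  have h2 : zeroLocus k (Ideal.span {b}) = ∅ := by
    ext p
    rw [zeroLocus_span]
    simpa [aeval_self_eq_eval] using h p
  rw [h2, vanishingIdeal_empty] at h1
  have := Ideal.radical_eq_top.1 h1.symm
  rw [Ideal.span_singleton_eq_top] at this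
  exact hb this

theorem mem_regular {U : NOpens k} {f : FnField k} :
    f ∈ regular U ↔ ∀ P ∈ U.1, f ∈ localRing P := by
  simp only [regular, Algebra.mem_iInf]

theorem aeval_mem_localRing (g : GL (Fin 3) k) {P : Plane k} (hP : P ∈ (chart g).1)
    (a : MvPolynomial (Fin 2) k) : aeval (affineCoords g) a ∈ localRing P :=
  (mem_localRing_iff g hP _).2 ⟨a, 1, by simp, by simp⟩

/-- The regular functions on an affine chart are the polynomials in its coordinates. -/
theorem exists_eq_aeval_of_mem_regular [IsAlgClosed k] (g : GL (Fin 3) k) {f : FnField k}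
    (hf : f ∈ regular (chart g)) :
    ∃ a : MvPolynomial (Fin 2) k, f = aeval (affineCoords g) a := by
  have : Infinite k := IsAlgClosed.instInfinite
  have inj := aeval_affineCoords_injective g
  rw [mem_regular] at hf
  obtain ⟨P₀, hP₀, -⟩ := exists_pt g 0
  obtain ⟨a, b, hb, hab⟩ := (mem_localRing_iff g hP₀ f).1 (hf P₀ hP₀)
  have hb0 : b ≠ 0 := by rintro rfl; simp at hb
  obtain ⟨a', b', d, hrel, rfl, rfl⟩ :=
    UniqueFactorizationMonoid.exists_reduced_factors' a b hb0
  have hd0 : aeval (affineCoords g) d ≠ 0 := by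
    rw [Ne, map_eq_zero_iff _ inj]
    exact left_ne_zero_of_mul hb0
  have hab' : f * aeval (affineCoords g) b' = aeval (affineCoords g) a' := by
    apply mul_left_cancel₀ hd0
    rw [← map_mul, ← hab, map_mul]; ring
  -- At a zero of the reduced denominator `b'`, a second fraction `c / e` with `e(P) ≠ 0` represents
  -- `f`. Coprimality gives `b' ∣ e`, a contradiction.
  have hunit : IsUnit b' := by
    by_contra hnu
    obtain ⟨q, hq⟩ := exists_eval_eq_zero_of_not_isUnit hnu
    obtain ⟨P, hP, rfl⟩ := exists_pt g q
    obtain ⟨c, e, he, hce⟩ := (mem_localRing_iff g hP f).1 (hf P hP)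
    have h1 : a' * e = b' * c := inj (by
      rw [map_mul, map_mul, ← hab', ← hce]; ring)
    obtain ⟨t, rfl⟩ := hrel.symm.dvd_of_dvd_mul_left (Dvd.intro _ h1.symm)
    rw [map_mul, hq, zero_mul] at he
    exact he rfl
  obtain ⟨u, rfl⟩ := hunit
  refine ⟨a' * (u⁻¹ : (MvPolynomial (Fin 2) k)ˣ), ?_⟩
  rw [map_mul, ← hab', mul_assoc, ← map_mul, Units.mul_inv, map_one, mul_one]

theorem derivation_aeval (D : RatVF k) (s : Fin 2 → FnField k) (a : MvPolynomial (Fin 2) k) :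
    D (aeval s a) = aeval s (pderiv 0 a) * D (s 0) + aeval s (pderiv 1 a) * D (s 1) := by
  induction a using MvPolynomial.induction_on with
  | C c => simp
  | add p q hp hq => rw [map_add, map_add, hp, hq]; simp only [map_add]; ring
  | mul_X p i hp =>
    simp only [map_mul, aeval_X, Derivation.leibniz, smul_eq_mul, hp, map_add]
    fin_cases i <;> simp [pderiv_X] <;> ring

theorem mem_localRing_of_mul_eq (g : GL (Fin 3) k) {P : Plane k} (hP : P ∈ (chart g).1)
    {f : FnField k} {b : MvPolynomial (Fin 2) k} (hb : eval (pt g P) b ≠ 0)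
    (hf : f * aeval (affineCoords g) b ∈ localRing P) : f ∈ localRing P := by
  obtain ⟨c, d, hd, h⟩ := (mem_localRing_iff g hP _).1 hf
  refine (mem_localRing_iff g hP _).2 ⟨c, b * d, ?_, ?_⟩
  · rw [map_mul]; exact mul_ne_zero hb hd
  · rw [map_mul, ← mul_assoc, h]

/-- A rational vector field with polynomial coefficients is regular on the affine chart. -/
theorem mem_tangent_chart (g : GL (Fin 3) k) {D : RatVF k} {F G : MvPolynomial (Fin 2) k}
    (hD : HasCoefficients D (affineCoords g) F G) : D ∈ tangent (chart g) := by
  intro P hP f hf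
  obtain ⟨a, b, hb, hab⟩ := (mem_localRing_iff g hP f).1 hf
  have hpoly : ∀ c : MvPolynomial (Fin 2) k, D (aeval (affineCoords g) c) ∈ localRing P := by
    intro c
    rw [derivation_aeval, hD.1, hD.2, ← map_mul, ← map_mul, ← map_add]
    exact aeval_mem_localRing g hP _
  apply mem_localRing_of_mul_eq g hP hb
  have h := congrArg D hab
  rw [Derivation.leibniz D f, smul_eq_mul, smul_eq_mul] at h
  have h2 : D f * aeval (affineCoords g) b =
      D (aeval (affineCoords g) a) - f * D (aeval (affineCoords g) b) := by
    rw [← h]; ring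
  rw [h2]
  exact sub_mem (hpoly a) (mul_mem hf (hpoly b))

theorem affineCoords_one : affineCoords (1 : GL (Fin 3) k) =
    fun i => algebraMap (MvPolynomial (Fin 2) k) (FnField k) (X i) := by
  funext i
  fin_cases i <;> simp [affineCoords, newHom, hom, Matrix.one_apply]

theorem aeval_affineCoords_one (a : MvPolynomial (Fin 2) k) :
    aeval (affineCoords (1 : GL (Fin 3) k)) a = algebraMap _ (FnField k) a := by
  rw [affineCoords_one]
  exact (MvPolynomial.aeval_algebraMap_apply (FnField k) X a).trans (by rw [aeval_X_left_apply])

theorem newCoords_one (P : Plane k) : newCoords 1 P = P.coords := by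
  funext i
  simp [newCoords, Matrix.one_apply]

/-- A rational vector field is determined by its coefficients. -/
theorem eq_zero_of_hasCoefficients_zero [Infinite k] (g : GL (Fin 3) k) {D : RatVF k}
    (h : HasCoefficients D (affineCoords g) 0 0) : D = 0 := by
  ext f
  obtain ⟨a, b, hb, rfl⟩ := IsFractionRing.div_surjective (A := MvPolynomial (Fin 2) k) f
  have hb0 : b ≠ 0 := nonZeroDivisors.ne_zero hb
  -- At a point lying in both charts where `b` does not vanish, `f` is also a fraction in the
  -- coordinates of `g`.
  obtain ⟨p, hp⟩ : ∃ p, eval p (b * newHomPoly g 0) ≠ 0 := by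
    by_contra! hz
    exact mul_ne_zero hb0 (newHomPoly_ne_zero g 0) (MvPolynomial.funext fun p => by simpa using hz p)
  rw [map_mul, mul_ne_zero_iff] at hp
  obtain ⟨P, hP, rfl⟩ := exists_pt 1 p
  have hPg : P ∈ (chart g).1 := by
    rw [mem_chart]
    rw [mem_chart, newCoords_one] at hP
    have : newCoords g P 0 = P.coords 0 * eval (pt 1 P) (newHomPoly g 0) := by
      simp only [pt, newCoords_one, newHomPoly, map_add, map_mul, eval_C, eval_X,
        Matrix.cons_val_zero, Matrix.cons_val_one]
      simp only [newCoords, Fin.sum_univ_three]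
      field_simp
    rw [this]
    exact mul_ne_zero hP hp.2
  have hf : algebraMap _ (FnField k) a / algebraMap _ (FnField k) b ∈ localRing P := by
    refine (mem_localRing_iff 1 hP _).2 ⟨a, b, hp.1, ?_⟩
    rw [aeval_affineCoords_one, aeval_affineCoords_one]
    exact div_mul_cancel₀ _ (by rwa [Ne, map_eq_zero_iff _ algebraMap_injective_fn])
  obtain ⟨c, d, hd, hcd⟩ := (mem_localRing_iff g hPg _).1 hf
  have hd0 : aeval (affineCoords g) d ≠ 0 := by
    rw [Ne, map_eq_zero_iff (aeval (R := k) (affineCoords g)) (aeval_affineCoords_injective g)]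
    rintro rfl; simp at hd
  have h1 := congrArg D hcd
  rw [Derivation.leibniz, derivation_aeval, derivation_aeval, h.1, h.2] at h1
  simpa [hd0] using h1

/-! ### Generators and saturation -/

theorem mem_sections_of_isGenerator {p : ℕ} {L : Foliation k p} {U : NOpens k} {e : RatVF k}
    (h : L.IsGenerator U e) : e ∈ L.sections U :=
  (h.2 U le_rfl e).2 ⟨1, one_mem _, (one_smul _ _).symm⟩

/-- By saturation, the coefficients of a generator have no common factors. -/
theorem isRelPrime_of_isGenerator [IsAlgClosed k] {p : ℕ} (L : Foliation k p) (g : GL (Fin 3) k)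
    {δ : RatVF k} {F G : MvPolynomial (Fin 2) k} (hδ : HasCoefficients δ (affineCoords g) F G)
    (hgen : ∀ P ∈ (chart g).1, ∃ W : NOpens k, P ∈ W.1 ∧ W ≤ chart g ∧ L.IsGenerator W δ) :
    IsRelPrime F G := by
  have : Infinite k := IsAlgClosed.instInfinite
  have inj := aeval_affineCoords_injective g
  rintro d ⟨F, rfl⟩ ⟨G, rfl⟩
  by_contra hd
  obtain ⟨q, hq⟩ := exists_eval_eq_zero_of_not_isUnit hd
  obtain ⟨P, hP, rfl⟩ := exists_pt g q
  obtain ⟨W, hPW, hW, hWδ⟩ := hgen P hP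
  have hd0 : d ≠ 0 := by
    rintro rfl
    refine hWδ.1 (eq_zero_of_hasCoefficients_zero g ?_)
    simpa using hδ
  set t := aeval (affineCoords g) d with ht
  have ht0 : t ≠ 0 := by rwa [Ne, ht, map_eq_zero_iff _ inj]
  -- Dividing by the common factor `d` keeps the field regular, so saturation puts it in `L`. Then
  -- `1 / d` is regular at a zero of `d`, which is absurd.
  have hD : t⁻¹ • δ ∈ tangent W := by
    have h1 : HasCoefficients (t⁻¹ • δ) (affineCoords g) F G := by
      constructor
      · rw [Derivation.smul_apply, hδ.1, map_mul, smul_eq_mul, inv_mul_cancel_left₀ ht0]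
      · rw [Derivation.smul_apply, hδ.2, map_mul, smul_eq_mul, inv_mul_cancel_left₀ ht0]
    exact fun Q hQ => mem_tangent_chart g h1 Q (hW hQ)
  have htW : t ∈ regular W := mem_regular.2 fun Q hQ => aeval_mem_localRing g (hW hQ) d
  have hsec := L.saturated W _ hD ⟨t, htW⟩ (fun h => ht0 (congrArg Subtype.val h)) (by
    have : (⟨t, htW⟩ : regular W) • t⁻¹ • δ = δ := by
      change t • t⁻¹ • δ = δ
      rw [smul_smul, mul_inv_cancel₀ ht0, one_smul]
    rw [this]
    exact mem_sections_of_isGenerator hWδ)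
  obtain ⟨f, hf, hfe⟩ := (hWδ.2 W le_rfl _).1 hsec
  have hft : t⁻¹ = f := smul_left_injective _ hWδ.1 hfe
  subst hft
  obtain ⟨a, b, hb, hab⟩ := (mem_localRing_iff g hP _).1 (mem_regular.1 hf P hPW)
  have : b = d * a := inj (by rw [map_mul, ← hab, mul_inv_cancel_left₀ ht0])
  rw [this, map_mul, hq, zero_mul] at hb
  exact hb rfl

/-! ### Degree bounds from the transition functions -/

/-- The exchange of the coordinates `X₀` and `X₁`. -/
def swapGL (k : Type u) [Field k] : GL (Fin 3) k where
  val := !![0, 1, 0; 1, 0, 0; 0, 0, 1]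
  inv := !![0, 1, 0; 1, 0, 0; 0, 0, 1]
  val_inv := by ext i j; fin_cases i <;> fin_cases j <;> simp [Matrix.mul_apply, Fin.sum_univ_three]
  inv_val := by ext i j; fin_cases i <;> fin_cases j <;> simp [Matrix.mul_apply, Fin.sum_univ_three]

theorem newCoords_swapGL (P : Plane k) : newCoords (swapGL k) P 0 = P.coords 1 := by
  simp [newCoords, swapGL, Fin.sum_univ_three]

theorem affineCoords_swapGL :
    affineCoords (swapGL k) = ![(hom k 1)⁻¹, hom k 2 / hom k 1] := by
  funext i
  fin_cases i <;> simp [affineCoords, newHom, swapGL, Fin.sum_univ_three, hom]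

theorem hom_one_ne_zero : hom k 1 ≠ 0 := by
  simp [hom, map_eq_zero_iff _ algebraMap_injective_fn]

theorem exists_clear_denominators (Q : MvPolynomial (Fin 2) k) :
    ∃ (N : ℕ) (R : MvPolynomial (Fin 2) k), R.totalDegree ≤ N ∧
      hom k 1 ^ N * aeval (affineCoords (swapGL k)) Q = algebraMap _ (FnField k) R := by
  have hx := hom_one_ne_zero (k := k)
  have hX : algebraMap (MvPolynomial (Fin 2) k) (FnField k) (X 0) = hom k 1 := rfl
  have hY : algebraMap (MvPolynomial (Fin 2) k) (FnField k) (X 1) = hom k 2 := rfl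
  have htX : ∀ (i : Fin 2) (N : ℕ), (X i ^ N : MvPolynomial (Fin 2) k).totalDegree ≤ N :=
    fun i N => (totalDegree_X_pow i N).le
  induction Q using MvPolynomial.induction_on with
  | C c =>
    exact ⟨0, C c, by simp, by
      rw [pow_zero, one_mul, algHom_C, ← algebraMap_eq, ← IsScalarTower.algebraMap_apply]⟩
  | add p q hp hq =>
    obtain ⟨N, R, hR, hR'⟩ := hp
    obtain ⟨M, S, hS, hS'⟩ := hq
    refine ⟨N + M, R * X 0 ^ M + X 0 ^ N * S, ?_, ?_⟩
    · refine (totalDegree_add _ _).trans (max_le ?_ ?_)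
      · exact (totalDegree_mul _ _).trans (add_le_add hR (htX _ _))
      · exact (totalDegree_mul _ _).trans (add_le_add (htX _ _) hS)
    · simp only [map_add, map_mul, map_pow, hX, ← hR', ← hS']
      ring
  | mul_X p i hp =>
    obtain ⟨N, R, hR, hR'⟩ := hp
    fin_cases i
    · refine ⟨N + 1, R, hR.trans (Nat.le_succ _), ?_⟩
      rw [map_mul, aeval_X, ← hR', affineCoords_swapGL]
      simp; field_simp; ring
    · refine ⟨N + 1, R * X 1, (totalDegree_mul _ _).trans (add_le_add hR (by simp)), ?_⟩
      rw [map_mul, map_mul, aeval_X, hY, ← hR', affineCoords_swapGL]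
      simp; field_simp; ring

/-- Clearing denominators gives `x ^ N * F = x ^ m * R` with `deg R ≤ N`; compare degrees. -/
theorem totalDegree_le_of_eq_pow_mul {F Q : MvPolynomial (Fin 2) k} {m : ℕ}
    (h : algebraMap _ (FnField k) F = hom k 1 ^ m * aeval (affineCoords (swapGL k)) Q) :
    F.totalDegree ≤ m := by
  by_cases hF : F = 0
  · simp [hF]
  obtain ⟨N, R, hR, hR'⟩ := exists_clear_denominators Q
  have h1 : X 0 ^ N * F = X 0 ^ m * R := by
    apply algebraMap_injective_fn
    rw [map_mul, map_mul, map_pow, map_pow, ← hR', h]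
    change hom k 1 ^ N * _ = hom k 1 ^ m * _
    ring
  have h2 := congrArg totalDegree h1
  rw [totalDegree_mul_of_isDomain (pow_ne_zero _ (X_ne_zero _)) hF, totalDegree_X_pow] at h2
  have h3 := totalDegree_mul (X 0 ^ m) R
  rw [totalDegree_X_pow] at h3
  omega

theorem apply_mem_regular {p : ℕ} {L : Foliation k p} {g : GL (Fin 3) k} {e : RatVF k}
    (he : L.IsGenerator (chart g) e) {f : FnField k} (hf : f ∈ regular (chart g)) :
    e f ∈ regular (chart g) := by
  rw [mem_regular] at hf ⊢
  exact fun P hP => L.le_tangent _ (mem_sections_of_isGenerator he) P hP f (hf P hP)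

theorem affineCoords_mem_regular (g : GL (Fin 3) k) (i : Fin 2) :
    affineCoords g i ∈ regular (chart g) := by
  rw [mem_regular]
  intro P hP
  simpa using aeval_mem_localRing g hP (X i)

theorem exists_hasCoefficients [IsAlgClosed k] {p : ℕ} {L : Foliation k p} {g : GL (Fin 3) k}
    {e : RatVF k} (he : L.IsGenerator (chart g) e) :
    ∃ F G, HasCoefficients e (affineCoords g) F G := by
  obtain ⟨F, hF⟩ := exists_eq_aeval_of_mem_regular g
    (apply_mem_regular he (affineCoords_mem_regular g 0))
  obtain ⟨G, hG⟩ := exists_eq_aeval_of_mem_regular g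
    (apply_mem_regular he (affineCoords_mem_regular g 1))
  exact ⟨F, G, hF, hG⟩

theorem isGenerator_chart_one {p : ℕ} {L : Foliation k p} {e : Fin 3 → RatVF k}
    (he : ∀ (i : Fin 3) (U : NOpens k), (U.1 : Set (Plane k)) = {P | P.coords i ≠ 0} →
      L.IsGenerator U (e i)) : L.IsGenerator (chart 1) (e 0) := by
  refine he 0 _ ?_
  ext P
  rw [SetLike.mem_coe, mem_chart, newCoords_one]
  rfl

theorem isGenerator_chart_swapGL {p : ℕ} {L : Foliation k p} {e : Fin 3 → RatVF k}
    (he : ∀ (i : Fin 3) (U : NOpens k), (U.1 : Set (Plane k)) = {P | P.coords i ≠ 0} →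
      L.IsGenerator U (e i)) : L.IsGenerator (chart (swapGL k)) (e 1) := by
  refine he 1 _ ?_
  ext P
  rw [SetLike.mem_coe, mem_chart, newCoords_swapGL]
  rfl

/-- The degree bounds for the coefficients of the generator on the chart `X₀ ≠ 0`. -/
theorem totalDegree_le_of_transition [IsAlgClosed k] {p : ℕ} {L : Foliation k p}
    {e₀ e₁ : RatVF k} (he₁ : L.IsGenerator (chart (swapGL k)) e₁) {n : ℤ}
    (he : e₁ = (hom k 1 / hom k 0) ^ n • e₀) {F G : MvPolynomial (Fin 2) k}
    (hFG : HasCoefficients e₀ (affineCoords 1) F G) {m j : ℕ} (hm : (j : ℤ) = m + n - 2) :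
    F.totalDegree ≤ m ∧ (X 0 * G - X 1 * F).totalDegree ≤ m := by
  have hx := hom_one_ne_zero (k := k)
  have h0 : hom k 0 = 1 := rfl
  obtain ⟨A, B, hA, hB⟩ := exists_hasCoefficients he₁
  have hF : e₀ (hom k 1) = algebraMap _ _ F := by
    have := hFG.1
    rwa [aeval_affineCoords_one, affineCoords_one] at this
  have hG : e₀ (hom k 2) = algebraMap _ _ G := by
    have := hFG.2
    rwa [aeval_affineCoords_one, affineCoords_one] at this
  rw [h0, div_one] at he
  have hz : hom k 1 ^ j = hom k 1 ^ m * hom k 1 ^ n / hom k 1 ^ 2 := by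
    rw [← zpow_natCast, hm, zpow_sub₀ hx, zpow_add₀ hx]
    simp
  have hu : aeval (affineCoords (swapGL k)) (X 0 ^ j : MvPolynomial (Fin 2) k) =
      (hom k 1 ^ j)⁻¹ := by
    rw [map_pow, aeval_X, affineCoords_swapGL]; simp
  have hzn : hom k 1 ^ n ≠ 0 := zpow_ne_zero _ hx
  -- The generator `e₁` sends `1/x` to `-x^(n-2) F` and `y/x` to `x^(n-2) (xG - yF)`, both
  -- polynomials in `1/x` and `y/x`. The exponent `j = m + n - 2` absorbs the gap between `x^(2-n)`
  -- and `x^m`.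
  constructor
  · rw [← totalDegree_neg]
    apply totalDegree_le_of_eq_pow_mul (Q := X 0 ^ j * A)
    rw [map_mul, ← hA, hu, affineCoords_swapGL, he, Derivation.smul_apply, hz]
    simp only [Matrix.cons_val_zero, Derivation.leibniz_inv, smul_eq_mul, hF, map_neg]
    field_simp
  · apply totalDegree_le_of_eq_pow_mul (Q := X 0 ^ j * B)
    rw [map_mul, ← hB, hu, affineCoords_swapGL, he, Derivation.smul_apply, hz]
    simp only [Matrix.cons_val_one, Matrix.cons_val_zero, Derivation.leibniz_div, smul_eq_mul, hF, hG, map_sub, map_mul]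
    change hom k 1 * _ - hom k 2 * _ = _
    field_simp

/-! ### The differential equations of a 2-closed field -/

theorem totalDegree_pderiv_lt {i : Fin 2} {F : MvPolynomial (Fin 2) k} (h : pderiv i F ≠ 0) :
    (pderiv i F).totalDegree < F.totalDegree := by
  obtain ⟨m, hm, hmd⟩ := Finset.exists_mem_eq_sup _ (support_nonempty.2 h)
    fun m : Fin 2 →₀ ℕ => m.sum fun _ e => e
  rw [totalDegree, hmd]
  rw [mem_support_iff, coeff_pderiv] at hm
  have := le_totalDegree (mem_support_iff.2 (left_ne_zero_of_mul hm))
  rw [Finsupp.sum_add_index' (fun _ => rfl) (fun _ _ _ => rfl), Finsupp.sum_single_index rfl]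
    at this
  omega

/-- A non-zero derivative has smaller degree than `F`, so it cannot be a multiple of `F`. -/
theorem pderiv_eq_zero_of_dvd {i : Fin 2} {F : MvPolynomial (Fin 2) k} (h : F ∣ pderiv i F) :
    pderiv i F = 0 := by
  by_contra h0
  obtain ⟨c, hc⟩ := h
  have h1 := totalDegree_pderiv_lt h0
  rw [hc] at h0
  rw [hc, totalDegree_mul_of_isDomain (left_ne_zero_of_mul h0) (right_ne_zero_of_mul h0)] at h1
  omega

theorem pderiv_eq_zero_of_isUnit {i : Fin 2} {F : MvPolynomial (Fin 2) k} (h : IsUnit F) :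
    pderiv i F = 0 :=
  pderiv_eq_zero_of_dvd h.dvd

/-- The differential equations satisfied by coprime coefficients of a `2`-closed vector field. -/
theorem pderiv_relations {F G f : MvPolynomial (Fin 2) k} (hrel : IsRelPrime F G)
    (hF : pderiv 0 F * F + pderiv 1 F * G = f * F) (hG : pderiv 0 G * F + pderiv 1 G * G = f * G) :
    pderiv 1 F = 0 ∧ pderiv 0 G = 0 ∧ pderiv 0 F = pderiv 1 G := by
  have h1 : pderiv 1 F = 0 := pderiv_eq_zero_of_dvd <| hrel.dvd_of_dvd_mul_right
    ⟨f - pderiv 0 F, by linear_combination hF⟩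
  have h2 : pderiv 0 G = 0 := pderiv_eq_zero_of_dvd <| hrel.symm.dvd_of_dvd_mul_right
    ⟨f - pderiv 1 G, by linear_combination hG⟩
  refine ⟨h1, h2, ?_⟩
  rw [h1, zero_mul, add_zero] at hF
  rw [h2, zero_mul, zero_add] at hG
  -- If one coefficient is zero, coprimality makes the other a unit, hence constant; otherwise both
  -- derivatives equal `f`.
  by_cases hF0 : F = 0
  · subst hF0
    rw [pderiv_eq_zero_of_isUnit (isRelPrime_zero_left.1 hrel)]
    simp
  by_cases hG0 : G = 0
  · subst hG0
    rw [pderiv_eq_zero_of_isUnit (isRelPrime_zero_right.1 hrel)]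
    simp
  rw [mul_right_cancel₀ hF0 hF, mul_right_cancel₀ hG0 hG]

/-! ### Comparison of coefficients -/

/-- The exponent of `x ^ i * y ^ j`. -/
def expo (i j : ℕ) : Fin 2 →₀ ℕ := Finsupp.single 0 i + Finsupp.single 1 j

theorem expo_apply_zero (i j : ℕ) : expo i j 0 = i := by simp [expo]
theorem expo_apply_one (i j : ℕ) : expo i j 1 = j := by simp [expo]

theorem eq_expo (m : Fin 2 →₀ ℕ) : m = expo (m 0) (m 1) := by
  ext i; fin_cases i
  · exact (expo_apply_zero _ _).symm
  · exact (expo_apply_one _ _).symm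

theorem expo_sum (i j : ℕ) : ((expo i j).sum fun _ e => e) = i + j := by
  rw [expo, Finsupp.sum_add_index' (fun _ => rfl) (fun _ _ _ => rfl), Finsupp.sum_single_index rfl,
    Finsupp.sum_single_index rfl]

theorem coeff_expo_eq_zero {F : MvPolynomial (Fin 2) k} {d i j : ℕ} (h : F.totalDegree ≤ d)
    (hij : d < i + j) : coeff (expo i j) F = 0 := by
  by_contra h0
  have := le_totalDegree (mem_support_iff.2 h0)
  rw [expo_sum] at this
  omega

theorem eq_sum_of_totalDegree_le {F : MvPolynomial (Fin 2) k} (h : F.totalDegree ≤ 3) :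
    F = ∑ i ∈ Finset.range 4, ∑ j ∈ Finset.range 4,
      C (coeff (expo i j) F) * (X 0 ^ i * X 1 ^ j) := by
  have key : ∀ i j, C (coeff (expo i j) F) * (X 0 ^ i * X 1 ^ j) =
      monomial (expo i j) (coeff (expo i j) F) := by
    intro i j
    rw [monomial_eq, expo, Finsupp.prod_add_index' (fun _ => pow_zero _) (fun _ => pow_add _)]
    simp
  simp only [key]
  rw [← Finset.sum_product']
  ext m
  rw [coeff_sum]
  by_cases hm : coeff m F = 0
  · rw [hm]
    symm
    refine Finset.sum_eq_zero fun p _ => ?_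
    rw [coeff_monomial]
    split_ifs with h
    · rw [h, hm]
    · rfl
  · have hd := le_totalDegree (mem_support_iff.2 hm)
    rw [eq_expo m, expo_sum] at hd
    rw [Finset.sum_eq_single (m 0, m 1)]
    · simp [← eq_expo m]
    · intro p _ hp
      rw [coeff_monomial, if_neg]
      rintro rfl
      simp [expo_apply_zero, expo_apply_one] at hp
    · intro hn
      simp only [Finset.mem_product, Finset.mem_range] at hn
      omega

theorem coeff_X_zero_mul (G : MvPolynomial (Fin 2) k) (i j : ℕ) :
    coeff (expo (i + 1) j) (X 0 * G) = coeff (expo i j) G := by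
  rw [← coeff_X_mul (expo i j) 0 G]
  congr 1
  simp only [expo, Finsupp.single_add]
  abel

theorem coeff_X_one_mul (G : MvPolynomial (Fin 2) k) (i j : ℕ) :
    coeff (expo i (j + 1)) (X 1 * G) = coeff (expo i j) G := by
  rw [← coeff_X_mul (expo i j) 1 G]
  congr 1
  simp only [expo, Finsupp.single_add]
  abel

theorem coeff_pderiv_zero (F : MvPolynomial (Fin 2) k) (i j : ℕ) :
    coeff (expo i j) (pderiv 0 F) = coeff (expo (i + 1) j) F * (i + 1) := by
  rw [coeff_pderiv, expo_apply_zero]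
  congr 2
  simp only [expo, Finsupp.single_add]
  abel

theorem coeff_pderiv_one (F : MvPolynomial (Fin 2) k) (i j : ℕ) :
    coeff (expo i j) (pderiv 1 F) = coeff (expo i (j + 1)) F * (j + 1) := by
  rw [coeff_pderiv, expo_apply_one]
  congr 2
  simp only [expo, Finsupp.single_add]
  abel

theorem coeff_X_zero_mul_of_zero (G : MvPolynomial (Fin 2) k) (j : ℕ) :
    coeff (expo 0 j) (X 0 * G) = 0 := by
  rw [coeff_X_mul', if_neg]
  simp [expo]

theorem coeff_X_one_mul_of_zero (G : MvPolynomial (Fin 2) k) (i : ℕ) :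
    coeff (expo i 0) (X 1 * G) = 0 := by
  rw [coeff_X_mul', if_neg]
  simp [expo]

theorem cast_three_eq_one_of_charTwo [CharP k 2] : (2 + 1 : k) = 1 := by
  rw [CharTwo.two_eq_zero, zero_add]

/-- The coefficients of a `2`-closed generator come from a Frobenius-linear map. -/
theorem exists_matrix_of_pderiv_relations [CharP k 2] {F G : MvPolynomial (Fin 2) k}
    (hF : F.totalDegree ≤ 3) (hFG : (X 0 * G - X 1 * F).totalDegree ≤ 3)
    (h₁ : pderiv 1 F = 0) (h₂ : pderiv 0 G = 0) (h₃ : pderiv 0 F = pderiv 1 G) :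
    ∃ M : Matrix (Fin 3) (Fin 3) k,
      F = X 0 * (C (M 0 0) + C (M 0 1) * X 0 ^ 2 + C (M 0 2) * X 1 ^ 2) +
        (C (M 1 0) + C (M 1 1) * X 0 ^ 2 + C (M 1 2) * X 1 ^ 2) ∧
      G = X 1 * (C (M 0 0) + C (M 0 1) * X 0 ^ 2 + C (M 0 2) * X 1 ^ 2) +
        (C (M 2 0) + C (M 2 1) * X 0 ^ 2 + C (M 2 2) * X 1 ^ 2) ∧
      (F.totalDegree ≤ 2 → (X 0 * G - X 1 * F).totalDegree ≤ 2 →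
        ∀ i, M i 1 = 0 ∧ M i 2 = 0) := by
  have hG : G.totalDegree ≤ 3 := by
    by_cases hG0 : G = 0
    · simp [hG0]
    have e : X 0 * G = (X 0 * G - X 1 * F) + X 1 * F := by ring
    have h := totalDegree_add (X 0 * G - X 1 * F) (X 1 * F)
    rw [← e, totalDegree_mul_of_isDomain (X_ne_zero _) hG0, totalDegree_X] at h
    have h' := totalDegree_mul (X 1) F
    rw [totalDegree_X] at h'
    have := h.trans (max_le_max hFG h')
    omega
  have t1 := cast_three_eq_one_of_charTwo (k := k)
  -- `F` is even in `y` and `G` is even in `x`, as odd integers are invertible in `k`.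
  have F1 : ∀ i, coeff (expo i 1) F = 0 := fun i => by
    simpa [h₁] using (coeff_pderiv_one F i 0).symm
  have F3 : ∀ i, coeff (expo i 3) F = 0 := fun i => by
    simpa [h₁, t1] using (coeff_pderiv_one F i 2).symm
  have G1 : ∀ j, coeff (expo 1 j) G = 0 := fun j => by
    simpa [h₂] using (coeff_pderiv_zero G 0 j).symm
  have G3 : ∀ j, coeff (expo 3 j) G = 0 := fun j => by
    simpa [h₂, t1] using (coeff_pderiv_zero G 2 j).symm
  have d1 : coeff (expo 1 0) F = coeff (expo 0 1) G := by
    have := congrArg (coeff (expo 0 0)) h₃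
    simpa [coeff_pderiv_zero, coeff_pderiv_one] using this
  -- The quartic part of `xG - yF` vanishes, so the cubic parts of `F` and `G` share the factor
  -- `q₀`.
  have d2 : coeff (expo 2 1) G = coeff (expo 3 0) F := by
    have := coeff_expo_eq_zero (i := 3) (j := 1) hFG (by norm_num)
    rw [coeff_sub, coeff_X_zero_mul, coeff_X_one_mul] at this
    exact sub_eq_zero.1 this
  have d3 : coeff (expo 0 3) G = coeff (expo 1 2) F := by
    have := coeff_expo_eq_zero (i := 1) (j := 3) hFG (by norm_num)
    rw [coeff_sub, coeff_X_zero_mul, coeff_X_one_mul] at this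
    exact sub_eq_zero.1 this
  have F22 := coeff_expo_eq_zero (i := 2) (j := 2) hF (by norm_num)
  have F32 := coeff_expo_eq_zero (i := 3) (j := 2) hF (by norm_num)
  have G22 := coeff_expo_eq_zero (i := 2) (j := 2) hG (by norm_num)
  have G23 := coeff_expo_eq_zero (i := 2) (j := 3) hG (by norm_num)
  refine ⟨!![coeff (expo 1 0) F, coeff (expo 3 0) F, coeff (expo 1 2) F;
    coeff (expo 0 0) F, coeff (expo 2 0) F, coeff (expo 0 2) F;
    coeff (expo 0 0) G, coeff (expo 2 0) G, coeff (expo 0 2) G], ?_, ?_, ?_⟩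
  · conv_lhs => rw [eq_sum_of_totalDegree_le hF]
    simp only [Finset.sum_range_succ, Finset.sum_range_zero, F1, F3, F22, F32, map_zero,
      Matrix.of_apply, Matrix.cons_val]
    ring
  · conv_lhs => rw [eq_sum_of_totalDegree_le hG]
    simp only [Finset.sum_range_succ, Finset.sum_range_zero, G1, G3, G22, G23, d2, d3, ← d1,
      map_zero, Matrix.of_apply, Matrix.cons_val]
    ring
  · intro hF2 hFG2
    have F30 := coeff_expo_eq_zero (i := 3) (j := 0) hF2 (by norm_num)
    have F12 := coeff_expo_eq_zero (i := 1) (j := 2) hF2 (by norm_num)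
    have c30 := coeff_expo_eq_zero (i := 3) (j := 0) hFG2 (by norm_num)
    have c21 := coeff_expo_eq_zero (i := 2) (j := 1) hFG2 (by norm_num)
    have c12 := coeff_expo_eq_zero (i := 1) (j := 2) hFG2 (by norm_num)
    have c03 := coeff_expo_eq_zero (i := 0) (j := 3) hFG2 (by norm_num)
    rw [coeff_sub, coeff_X_zero_mul, coeff_X_one_mul_of_zero, sub_zero] at c30
    rw [coeff_sub, coeff_X_zero_mul, coeff_X_one_mul, G1, zero_sub, neg_eq_zero] at c21
    rw [coeff_sub, coeff_X_zero_mul, coeff_X_one_mul, F1, sub_zero] at c12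
    rw [coeff_sub, coeff_X_zero_mul_of_zero, coeff_X_one_mul, zero_sub, neg_eq_zero] at c03
    intro i
    fin_cases i <;> simp [F30, F12, c30, c21, c12, c03]

/-! ### Eigenvectors of Frobenius-linear maps -/

/-- This is the additive equation `a s⁸ + b s⁴ + c s² = s` divided by `s`; its roots are the
non-zero solutions. -/
theorem exists_root_additive [IsAlgClosed k] (a b c : k) (h : a ≠ 0 ∨ b ≠ 0 ∨ c ≠ 0) :
    ∃ s, a * s ^ 7 + b * s ^ 3 + c * s = 1 := by
  let p : Polynomial k := .C a * .X ^ 7 + .C b * .X ^ 3 + .C c * .X - 1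
  have hp : p.degree ≠ 0 := by
    intro hd
    have hz : ∀ n : ℕ, 0 < n → p.coeff n = 0 := fun n hn =>
      Polynomial.coeff_eq_zero_of_degree_lt (by rw [hd]; exact_mod_cast hn)
    have h7 := hz 7 (by norm_num)
    have h3 := hz 3 (by norm_num)
    have h1 := hz 1 (by norm_num)
    simp [p, Polynomial.coeff_X_pow, Polynomial.coeff_one] at h7 h3 h1
    tauto
  obtain ⟨s, hs⟩ := IsAlgClosed.exists_root p hp
  refine ⟨s, ?_⟩
  simp only [p, Polynomial.IsRoot, Polynomial.eval_sub, Polynomial.eval_add, Polynomial.eval_mul,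
    Polynomial.eval_C, Polynomial.eval_pow, Polynomial.eval_X, Polynomial.eval_one] at hs
  exact sub_eq_zero.1 hs

/-- A Frobenius-linear map in dimension three over an algebraically closed field has an
eigenvector. -/
theorem exists_frobenius_eigenvector [IsAlgClosed k] [CharP k 2] {V : Type*} [AddCommGroup V] [Module k V]
    [Module.Finite k V] (hV : Module.finrank k V = 3) (φ : V → V)
    (hadd : ∀ v w, φ (v + w) = φ v + φ w) (hsmul : ∀ (c : k) v, φ (c • v) = c ^ 2 • φ v) :
    ∃ w, w ≠ 0 ∧ ∃ l : k, φ w = l • w := by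
  by_contra! hno
  have hker : ∀ w, w ≠ 0 → φ w ≠ 0 := fun w hw h => hno w hw 0 (by rw [h, zero_smul])
  have : Nontrivial V := Module.nontrivial_of_finrank_pos (R := k) (by omega)
  obtain ⟨v, hv⟩ := exists_ne (0 : V)
  have r2 : ∀ c₀ c₁ : k, φ (φ v) ≠ c₀ • v + c₁ • φ v := by
    intro c₀ c₁ h
    -- A vector `α v + s φ(v)` is fixed when `α = c₀ s²` and `s = α² + c₁ s²`; eliminate `α` and
    -- divide by `s`.
    obtain ⟨s, hs⟩ := exists_root_additive 0 (c₀ ^ 2) c₁ (by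
      by_contra! hz
      obtain ⟨-, h0, h1⟩ := hz
      rw [pow_eq_zero_iff two_ne_zero] at h0
      rw [h0, h1, zero_smul, zero_smul, zero_add] at h
      exact hker _ (hker v hv) h)
    have hs0 : s ≠ 0 := by rintro rfl; simp at hs
    have hw : φ ((c₀ * s ^ 2) • v + s • φ v) = (1 : k) • ((c₀ * s ^ 2) • v + s • φ v) := by
      rw [hadd, hsmul, hsmul, h]
      linear_combination (norm := module) (s * hs) • φ v
    refine hno _ ?_ 1 hw
    intro h0
    refine hno v hv (-(s⁻¹ * (c₀ * s ^ 2))) ?_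
    have e : s⁻¹ * s = 1 := inv_mul_cancel₀ hs0
    linear_combination (norm := module) s⁻¹ • h0 - e • φ v
  have r3 : ∀ c₀ c₁ c₂ : k, φ (φ (φ v)) ≠ c₀ • v + c₁ • φ v + c₂ • φ (φ v) := by
    intro c₀ c₁ c₂ h
    -- The same for `α v + β φ(v) + s φ²(v)`: here `α = c₀ s²`, `β = α² + c₁ s²` and `s = β² + c₂
    -- s²`.
    obtain ⟨s, hs⟩ := exists_root_additive (c₀ ^ 4) (c₁ ^ 2) c₂ (by
      by_contra! hz
      obtain ⟨h0, h1, h2⟩ := hz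
      rw [pow_eq_zero_iff (by norm_num)] at h0 h1
      rw [h0, h1, h2, zero_smul, zero_smul, zero_smul, zero_add, zero_add] at h
      exact hker _ (hker _ (hker v hv)) h)
    have hs0 : s ≠ 0 := by rintro rfl; simp at hs
    have hw : φ ((c₀ * s ^ 2) • v + (c₀ ^ 2 * s ^ 4 + c₁ * s ^ 2) • φ v + s • φ (φ v)) =
        (1 : k) • ((c₀ * s ^ 2) • v + (c₀ ^ 2 * s ^ 4 + c₁ * s ^ 2) • φ v + s • φ (φ v)) := by
      rw [hadd, hadd, hsmul, hsmul, hsmul, h, CharTwo.add_sq]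
      linear_combination (norm := module) (s * hs) • φ (φ v)
    refine hno _ ?_ 1 hw
    intro h0
    refine r2 (-(s⁻¹ * (c₀ * s ^ 2))) (-(s⁻¹ * (c₀ ^ 2 * s ^ 4 + c₁ * s ^ 2))) ?_
    have e : s⁻¹ * s = 1 := inv_mul_cancel₀ hs0
    linear_combination (norm := module) s⁻¹ • h0 - e • φ (φ v)
  have hli : ¬ LinearIndependent k ![v, φ v, φ (φ v), φ (φ (φ v))] := by
    intro h
    have := h.fintype_card_le_finrank
    rw [hV, Fintype.card_fin] at this
    omega
  obtain ⟨c, hc, i, hi⟩ := Fintype.not_linearIndependent_iff.1 hli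
  simp only [Fin.sum_univ_four, Matrix.cons_val] at hc
  -- The last non-zero coefficient of the dependence expresses an iterate of `v` by the earlier
  -- ones, which is excluded in each case.
  by_cases h3 : c 3 = 0
  · by_cases h2 : c 2 = 0
    · by_cases h1 : c 1 = 0
      · have h0 : c 0 ≠ 0 := by fin_cases i <;> simp_all
        rw [h1, h2, h3] at hc
        simp [h0, hv] at hc
      · refine hno v hv (-((c 1)⁻¹ * c 0)) ?_
        have e : (c 1)⁻¹ * c 1 = 1 := inv_mul_cancel₀ h1
        rw [h2, h3] at hc
        linear_combination (norm := module) (c 1)⁻¹ • hc - e • φ v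
    · refine r2 (-((c 2)⁻¹ * c 0)) (-((c 2)⁻¹ * c 1)) ?_
      have e : (c 2)⁻¹ * c 2 = 1 := inv_mul_cancel₀ h2
      rw [h3] at hc
      linear_combination (norm := module) (c 2)⁻¹ • hc - e • φ (φ v)
  · refine r3 (-((c 3)⁻¹ * c 0)) (-((c 3)⁻¹ * c 1)) (-((c 3)⁻¹ * c 2)) ?_
    have e : (c 3)⁻¹ * c 3 = 1 := inv_mul_cancel₀ h3
    linear_combination (norm := module) (c 3)⁻¹ • hc - e • φ (φ (φ v))

/-! ### Generators under change of coordinates -/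

/-- Replacing column `i₀` of the identity by `v` gives determinant `v i₀ ≠ 0`; a column swap then
moves `v` to the front. -/
theorem exists_inv_col_eq {v : Fin 3 → k} (hv : v ≠ 0) :
    ∃ g : GL (Fin 3) k, ∀ i, (g⁻¹).1 i 0 = v i := by
  obtain ⟨i₀, hi⟩ := Function.ne_iff.1 hv
  let N : Matrix (Fin 3) (Fin 3) k := Matrix.updateCol 1 i₀ v
  have hN : IsUnit N := by
    rw [Matrix.isUnit_iff_isUnit_det, ← Matrix.cramer_apply, Matrix.cramer_one]
    exact isUnit_iff_ne_zero.2 hi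
  have hN' : IsUnit (N.submatrix (Equiv.refl _) (Equiv.swap 0 i₀)) :=
    (Matrix.isUnit_submatrix_equiv _ _).2 hN
  obtain ⟨u, hu⟩ := hN'
  refine ⟨u⁻¹, fun i => ?_⟩
  rw [inv_inv, hu]
  simp [N]

theorem Foliation.IsGenerator.mono {p : ℕ} {L : Foliation k p} {U V : NOpens k} {e : RatVF k}
    (h : L.IsGenerator U e) (hV : V ≤ U) : L.IsGenerator V e :=
  ⟨h.1, fun W hW => h.2 W (hW.trans hV)⟩

theorem regular_mono {U V : NOpens k} (h : V ≤ U) {f : FnField k} (hf : f ∈ regular U) :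
    f ∈ regular V :=
  mem_regular.2 fun P hP => mem_regular.1 hf P (h hP)

theorem Foliation.IsGenerator.smul {p : ℕ} {L : Foliation k p} {U : NOpens k} {e : RatVF k}
    (h : L.IsGenerator U e) {c : FnField k} (hc0 : c ≠ 0) (hc : c ∈ regular U)
    (hc' : c⁻¹ ∈ regular U) : L.IsGenerator U (c • e) := by
  refine ⟨smul_ne_zero hc0 h.1, fun V hV D => (h.2 V hV D).trans ⟨?_, ?_⟩⟩
  · rintro ⟨f, hf, rfl⟩
    refine ⟨f * c⁻¹, mul_mem hf (regular_mono hV hc'), ?_⟩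
    rw [smul_smul, inv_mul_cancel_right₀ hc0]
  · rintro ⟨f, hf, rfl⟩
    exact ⟨f * c, mul_mem hf (regular_mono hV hc), smul_smul _ _ _⟩

/-- The intersection of two open sets having a common point. -/
def interNOpens (U V : NOpens k) {P : Plane k} (hU : P ∈ U.1) (hV : P ∈ V.1) : NOpens k :=
  ⟨U.1 ⊓ V.1, fun h => by
    have : P ∈ U.1 ⊓ V.1 := ⟨hU, hV⟩
    rw [h] at this
    exact this⟩

theorem interNOpens_le_left {U V : NOpens k} {P : Plane k} (hU : P ∈ U.1) (hV : P ∈ V.1) :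
    interNOpens U V hU hV ≤ U := fun _ h => h.1

theorem interNOpens_le_right {U V : NOpens k} {P : Plane k} (hU : P ∈ U.1) (hV : P ∈ V.1) :
    interNOpens U V hU hV ≤ V := fun _ h => h.2

/-- The open set `X i ≠ 0`. -/
def basicNOpens (i : Fin 3) {P : Plane k} (hP : P.coords i ≠ 0) : NOpens k :=
  ⟨⟨{Q | Q.coords i ≠ 0}, isOpen_generateFrom_of_mem
    ⟨1, X i, isHomogeneous_X k i, by simp⟩⟩, fun h => by
    have : P ∈ (⊥ : Opens (Plane k)) := by
      rw [← h]
      exact hP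
    exact this⟩

theorem hom_ne_zero (i : Fin 3) : hom k i ≠ 0 := by
  fin_cases i <;> simp [hom, map_eq_zero_iff _ algebraMap_injective_fn]

theorem hom_div_newHom_mem_localRing (g : GL (Fin 3) k) (i : Fin 3) {P : Plane k}
    (hP : P ∈ (chart g).1) : hom k i / newHom g 0 ∈ localRing P := by
  refine ⟨1, X i, linSubst g (X 0), isHomogeneous_X k i,
    isHomogeneous_linSubst g (isHomogeneous_X k 0), ?_, ?_⟩
  · rw [eval_coords_linSubst, eval_X]
    exact hP
  · rw [aeval_hom_linSubst, aeval_X, aeval_X, div_mul_cancel₀ _ (newHom_ne_zero g 0)]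

theorem newHom_div_hom_mem_localRing (g : GL (Fin 3) k) (i : Fin 3) {P : Plane k}
    (hP : P.coords i ≠ 0) : newHom g 0 / hom k i ∈ localRing P := by
  refine ⟨1, linSubst g (X 0), X i, isHomogeneous_linSubst g (isHomogeneous_X k 0),
    isHomogeneous_X k i, by simpa using hP, ?_⟩
  rw [aeval_hom_linSubst, aeval_X, aeval_X, div_mul_cancel₀ _ (hom_ne_zero i)]

/-- In degree `-1` the vector field `(1 / X'₀) e` generates `L` on the chart `X'₀ ≠ 0`. -/
theorem exists_isGenerator_of_degree_neg_one {p : ℕ} {L : Foliation k p} {e : Fin 3 → RatVF k}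
    (he : ∀ (i : Fin 3) (U : NOpens k), (U.1 : Set (Plane k)) = {P | P.coords i ≠ 0} →
      L.IsGenerator U (e i))
    (htr : ∀ i j : Fin 3, e i = (hom k i / hom k j) ^ (-1 : ℤ) • e j) (g : GL (Fin 3) k)
    {P : Plane k} (hP : P ∈ (chart g).1) :
    ∃ W : NOpens k, P ∈ W.1 ∧ W ≤ chart g ∧ L.IsGenerator W ((newHom g 0)⁻¹ • e 0) := by
  obtain ⟨i, hi⟩ := Function.ne_iff.1 (coords_ne_zero P)
  let U := basicNOpens i hi
  have hPU : P ∈ U.1 := hi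
  refine ⟨interNOpens (chart g) U hP hPU, ⟨hP, hPU⟩, interNOpens_le_left _ _, ?_⟩
  have hi0 := hom_ne_zero (k := k) i
  have hg0 := newHom_ne_zero g 0
  -- In degree `-1` the product `Xᵢ eᵢ` does not depend on `i`, and `Xᵢ / X'₀` is a unit on the
  -- overlap.
  have e1 : (newHom g 0)⁻¹ • e 0 = (hom k i / newHom g 0) • e i := by
    have h0 : hom k 0 = 1 := rfl
    rw [htr i 0, smul_smul, h0, div_one, zpow_neg_one]
    congr 1
    field_simp
  rw [e1]
  refine ((he i U rfl).mono (interNOpens_le_right _ _)).smul (div_ne_zero hi0 hg0) ?_ ?_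
  · exact mem_regular.2 fun Q hQ => hom_div_newHom_mem_localRing g i hQ.1
  · rw [inv_div]
    exact mem_regular.2 fun Q hQ => newHom_div_hom_mem_localRing g i hQ.2

theorem Foliation.Corresponds.equivalent {p : ℕ} {L : Foliation k p} {δ₀ e : RatVF k}
    (h : L.Corresponds δ₀) {g : GL (Fin 3) k} (he : L.IsGenerator (chart g) e) :
    Equivalent δ₀ e := by
  obtain ⟨P, hP, -⟩ := exists_pt g 0
  obtain ⟨U, hPU, α, e', hα, he', rfl⟩ := h P
  have hmem := mem_sections_of_isGenerator (he'.mono (interNOpens_le_left hPU hP))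
  obtain ⟨f, -, hf⟩ := ((he.mono (interNOpens_le_right hPU hP)).2 _ le_rfl _).1 hmem
  refine ⟨α * f, mul_ne_zero hα ?_, by rw [hf, smul_smul]⟩
  rintro rfl
  rw [zero_smul] at hf
  exact he'.1 hf

theorem Equivalent.smul_right {δ δ' : RatVF k} (h : Equivalent δ δ') {u : FnField k} (hu : u ≠ 0) :
    Equivalent δ (u • δ') := by
  obtain ⟨α, hα, rfl⟩ := h
  exact ⟨α * u⁻¹, mul_ne_zero hα (inv_ne_zero hu), by
    rw [smul_smul, inv_mul_cancel_right₀ hu]⟩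

/-! ### The generator as a Frobenius-linear map -/

theorem charP_fnField [CharP k 2] : CharP (FnField k) 2 :=
  charP_of_injective_algebraMap (algebraMap k (FnField k)).injective 2

/-- The value of the Frobenius-linear map with matrix `M` at `(1, x, y)`. -/
def frobForm (M : Matrix (Fin 3) (Fin 3) k) (i : Fin 3) : FnField k :=
  ∑ j, algebraMap k (FnField k) (M i j) * hom k j ^ 2

/-- The generator of a `1`-foliation of degree at least `-1`. -/
theorem exists_frobForm [IsAlgClosed k] [CharP k 2] {L : Foliation k 2} {e : Fin 3 → RatVF k}
    {n : ℤ} (hn : -1 ≤ n)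
    (he : ∀ (i : Fin 3) (U : NOpens k), (U.1 : Set (Plane k)) = {P | P.coords i ≠ 0} →
      L.IsGenerator U (e i))
    (htr : ∀ i j : Fin 3, e i = (hom k i / hom k j) ^ n • e j) :
    ∃ M : Matrix (Fin 3) (Fin 3) k,
      (∀ i, e 0 (hom k i) = hom k i * frobForm M 0 + frobForm M i) ∧
      (0 ≤ n → ∀ i, M i 1 = 0 ∧ M i 2 = 0) := by
  have : Infinite k := IsAlgClosed.instInfinite
  have := charP_fnField (k := k)
  have inj := aeval_affineCoords_injective (1 : GL (Fin 3) k)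
  have h0 := isGenerator_chart_one he
  have h1 := isGenerator_chart_swapGL he
  obtain ⟨F, G, hFG⟩ := exists_hasCoefficients h0
  have hrel : IsRelPrime F G :=
    isRelPrime_of_isGenerator L 1 hFG fun P hP => ⟨chart 1, hP, le_rfl, h0⟩
  obtain ⟨E, hE, hE2⟩ := L.pow_closed _ _ (mem_sections_of_isGenerator h0)
  obtain ⟨f, hf, rfl⟩ := (h0.2 _ le_rfl _).1 hE
  obtain ⟨c, rfl⟩ := exists_eq_aeval_of_mem_regular 1 hf
  have hcl : ∀ h, aeval (affineCoords (1 : GL (Fin 3) k)) c * e 0 h = e 0 (e 0 h) := hE2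
  have q1 := hcl (affineCoords 1 0)
  have q2 := hcl (affineCoords 1 1)
  rw [hFG.1, derivation_aeval, hFG.1, hFG.2, ← map_mul, ← map_mul, ← map_mul, ← map_add] at q1
  rw [hFG.2, derivation_aeval, hFG.1, hFG.2, ← map_mul, ← map_mul, ← map_mul, ← map_add] at q2
  obtain ⟨p1, p2, p3⟩ := pderiv_relations hrel (inj q1).symm (inj q2).symm
  obtain ⟨dF, dFG⟩ := totalDegree_le_of_transition (m := 3) (j := (n + 1).toNat) h1 (htr 1 0) hFG
    (by push_cast; omega)
  obtain ⟨M, hF, hG, hM⟩ := exists_matrix_of_pderiv_relations dF dFG p1 p2 p3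
  refine ⟨M, ?_, ?_⟩
  · have a1 := hFG.1
    have a2 := hFG.2
    rw [aeval_affineCoords_one, affineCoords_one] at a1 a2
    have hC : ∀ c : k, algebraMap (MvPolynomial (Fin 2) k) (FnField k) (C c) =
        algebraMap k (FnField k) c := fun c => (IsScalarTower.algebraMap_apply k _ _ c).symm
    have hX : algebraMap (MvPolynomial (Fin 2) k) (FnField k) (X 0) = hom k 1 := rfl
    have hY : algebraMap (MvPolynomial (Fin 2) k) (FnField k) (X 1) = hom k 2 := rfl
    have h00 : hom k 0 = 1 := rfl
    have key : ∀ i, frobForm M i = algebraMap _ (FnField k)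
        (C (M i 0) + C (M i 1) * X 0 ^ 2 + C (M i 2) * X 1 ^ 2 : MvPolynomial (Fin 2) k) := by
      intro i
      simp only [frobForm, Fin.sum_univ_three, map_add, map_mul, map_pow, hC, hX, hY, h00]
      ring
    intro i
    fin_cases i
    · change e 0 (hom k 0) = hom k 0 * frobForm M 0 + frobForm M 0
      -- For `i = 0` the formula reads `D 1 = 2 q₀ = 0`.
      rw [h00, one_mul, CharTwo.add_self_eq_zero, Derivation.map_one_eq_zero]
    · change e 0 (hom k 1) = hom k 1 * frobForm M 0 + frobForm M 1
      rw [key, key, ← hX, ← map_mul, ← map_add, ← hF]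
      exact a1
    · change e 0 (hom k 2) = hom k 2 * frobForm M 0 + frobForm M 2
      rw [key, key, ← hY, ← map_mul, ← map_add, ← hG]
      exact a2
  · intro hn0
    obtain ⟨dF2, dFG2⟩ := totalDegree_le_of_transition (m := 2) (j := n.toNat) h1 (htr 1 0) hFG
      (by push_cast; omega)
    exact hM dF2 dFG2

/-- The derivative of a quotient of linear forms. -/
theorem apply_newHom_div [CharP k 2] {D : RatVF k} {φ : Fin 3 → FnField k}
    (hD : ∀ i, D (hom k i) = hom k i * φ 0 + φ i) (g : GL (Fin 3) k) (i : Fin 3) :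
    D (newHom g i / newHom g 0) =
      ((∑ j, algebraMap k (FnField k) (g.1 i j) * φ j) * newHom g 0 +
        newHom g i * ∑ j, algebraMap k (FnField k) (g.1 0 j) * φ j) / newHom g 0 ^ 2 := by
  have := charP_fnField (k := k)
  have h : ∀ i, D (newHom g i) =
      newHom g i * φ 0 + ∑ j, algebraMap k (FnField k) (g.1 i j) * φ j := by
    intro i
    simp only [newHom, map_sum, Derivation.leibniz, Derivation.map_algebraMap, smul_eq_mul,
      mul_zero, add_zero, hD, mul_add, Finset.sum_add_distrib, Finset.sum_mul, mul_assoc]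
  rw [Derivation.leibniz_div, h, h]
  simp only [smul_eq_mul, CharTwo.sub_eq_add]
  -- The terms in `φ 0` are a multiple of the Euler field and cancel on quotients of linear forms.
  have h2 : newHom g 0 * (newHom g i * φ 0) + newHom g i * (newHom g 0 * φ 0) = 0 := by
    rw [show newHom g i * (newHom g 0 * φ 0) = newHom g 0 * (newHom g i * φ 0) by ring]
    exact CharTwo.add_self_eq_zero _
  rw [div_eq_mul_inv, inv_pow]
  linear_combination (newHom g 0 ^ 2)⁻¹ * h2

/-- A Frobenius-linear map in new coordinates. -/
theorem sum_mul_frobForm [CharP k 2] (M : Matrix (Fin 3) (Fin 3) k) (g : GL (Fin 3) k)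
    (i : Fin 3) :
    ∑ j, algebraMap k (FnField k) (g.1 i j) * frobForm M j =
      ∑ m, algebraMap k (FnField k) (∑ j, g.1 i j * ∑ l, M j l * (g⁻¹).1 l m ^ 2) *
        newHom g m ^ 2 := by
  have := charP_fnField (k := k)
  have h : ∀ l, hom k l ^ 2 =
      ∑ m, algebraMap k (FnField k) ((g⁻¹).1 l m) ^ 2 * newHom g m ^ 2 := by
    intro l
    rw [← sum_inv_newHom g l, CharTwo.sum_sq]
    simp only [mul_pow]
  simp only [frobForm, h, Fin.sum_univ_three, map_add, map_mul, map_pow]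
  ring

theorem sum_mul_inv_col (g : GL (Fin 3) k) (i : Fin 3) :
    ∑ j, g.1 i j * (g⁻¹).1 j 0 = if i = 0 then 1 else 0 := by
  have h : g.1 * (g⁻¹).1 = 1 := by rw [← Units.val_mul]; simp
  have := congrFun (congrFun h i) 0
  rwa [Matrix.mul_apply, Matrix.one_apply] at this

end PlaneFoliation

end

/-! ### The normal form -/

open PlaneFoliation in
theorem lemma3p2 {k : Type*} [Field k] [IsAlgClosed k] [CharP k 2]
    (L : PlaneFoliation.Foliation k 2) (hL : L.IsInvertible)
    (n : ℤ) (hdeg : L.HasDegree n) (hn : -1 ≤ n)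
    (δ₀ : PlaneFoliation.RatVF k) (h₀ : δ₀ ≠ 0) (hp : PlaneFoliation.IsPClosed 2 δ₀)
    (hδ₀ : L.Corresponds δ₀) :
    ∃ (g : GL (Fin 3) k) (a₃₀ a₁₂ a₂₀ a₀₂ a₁₀ b₂₀ b₀₂ : k) (F G : MvPolynomial (Fin 2) k)
      (δ : PlaneFoliation.RatVF k),
      PlaneFoliation.Equivalent δ₀ δ ∧
      PlaneFoliation.HasCoefficients δ (PlaneFoliation.affineCoords g) F G ∧
      F = C a₃₀ * X 0 ^ 3 + C a₁₂ * X 0 * X 1 ^ 2 + C a₂₀ * X 0 ^ 2 + C a₀₂ * X 1 ^ 2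
        + C a₁₀ * X 0 ∧
      G = C a₃₀ * X 0 ^ 2 * X 1 + C a₁₂ * X 1 ^ 3 + C b₂₀ * X 0 ^ 2 + C b₀₂ * X 1 ^ 2
        + C a₁₀ * X 1 ∧
      F ≠ 0 ∧ G ≠ 0 ∧ IsRelPrime F G := by
  have : Infinite k := IsAlgClosed.instInfinite
  obtain ⟨e, he, htr⟩ := hdeg
  obtain ⟨M, hM, hMn⟩ := exists_frobForm hn he htr
  have hgen := isGenerator_chart_one he
  have hequiv := hδ₀.equivalent hgen
  rcases lt_or_ge n 0 with hneg | hpos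
  · obtain rfl : n = -1 := by omega
    obtain ⟨v, hv, l, hvl⟩ := exists_frobenius_eigenvector (k := k) (V := Fin 3 → k)
      (by simp) (fun w i => ∑ j, M i j * w j ^ 2)
      (fun v w => by
        funext i
        simp only [Pi.add_apply, CharTwo.add_sq, mul_add, Finset.sum_add_distrib])
      (fun c v => by
        funext i
        simp only [Pi.smul_apply, smul_eq_mul, Finset.mul_sum]
        exact Finset.sum_congr rfl fun j _ => by ring)
    obtain ⟨g, hg⟩ := exists_inv_col_eq hv
    let M' : Matrix (Fin 3) (Fin 3) k := fun i m =>
      ∑ j, g.1 i j * ∑ l, M j l * (g⁻¹).1 l m ^ 2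
    -- The first column of `M'` is the image of the eigenvector in the new basis; its lower entries
    -- are the constant terms of the new coefficients.
    have hcol : ∀ i, M' i 0 = if i = 0 then l else 0 := by
      intro i
      have h1 : ∀ j, ∑ l, M j l * (g⁻¹).1 l 0 ^ 2 = l * (g⁻¹).1 j 0 := by
        intro j
        simp only [hg]
        exact congrFun hvl j
      have h2 : M' i 0 = l * ∑ j, g.1 i j * (g⁻¹).1 j 0 := by
        rw [Finset.mul_sum]
        exact Finset.sum_congr rfl fun j _ => by rw [h1]; ring
      rw [h2, sum_mul_inv_col]
      simp
    have hg0 := newHom_ne_zero g 0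
    have happ : ∀ i, ((newHom g 0)⁻¹ • e 0) (newHom g i / newHom g 0) =
        (∑ m, algebraMap k (FnField k) (M' i m) * (newHom g m / newHom g 0) ^ 2) +
          (newHom g i / newHom g 0) *
            ∑ m, algebraMap k (FnField k) (M' 0 m) * (newHom g m / newHom g 0) ^ 2 := by
      intro i
      rw [Derivation.smul_apply, apply_newHom_div hM, sum_mul_frobForm, sum_mul_frobForm]
      change (newHom g 0)⁻¹ • (((∑ m, algebraMap k (FnField k) (M' i m) * newHom g m ^ 2) * newHom g 0 +
        newHom g i * ∑ m, algebraMap k (FnField k) (M' 0 m) * newHom g m ^ 2) / newHom g 0 ^ 2) = _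
      simp only [Fin.sum_univ_three, smul_eq_mul]
      field_simp
    have hFG : ∀ i : Fin 2, ((newHom g 0)⁻¹ • e 0) (affineCoords g i) =
        aeval (affineCoords g) (C (M' 0 1) * X 0 ^ 2 * X i + C (M' 0 2) * X 1 ^ 2 * X i +
          C (M' i.succ 1) * X 0 ^ 2 + C (M' i.succ 2) * X 1 ^ 2 + C l * X i) := by
      intro i
      have hs : affineCoords g i = newHom g i.succ / newHom g 0 := by fin_cases i <;> rfl
      rw [hs, happ]
      have c0 := hcol 0
      have ci := hcol i.succ
      rw [if_pos rfl] at c0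
      rw [if_neg (Fin.succ_ne_zero i)] at ci
      have hs0 : affineCoords g 0 = newHom g 1 / newHom g 0 := rfl
      have hs1 : affineCoords g 1 = newHom g 2 / newHom g 0 := rfl
      simp only [Fin.sum_univ_three, c0, ci, map_zero, map_add, map_mul, map_pow, algHom_C, aeval_X,
        hs, hs0, hs1, div_self hg0]
      ring
    set F : MvPolynomial (Fin 2) k := C (M' 0 1) * X 0 ^ 3 + C (M' 0 2) * X 0 * X 1 ^ 2 +
      C (M' 1 1) * X 0 ^ 2 + C (M' 1 2) * X 1 ^ 2 + C l * X 0 with hF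
    set G : MvPolynomial (Fin 2) k := C (M' 0 1) * X 0 ^ 2 * X 1 + C (M' 0 2) * X 1 ^ 3 +
      C (M' 2 1) * X 0 ^ 2 + C (M' 2 2) * X 1 ^ 2 + C l * X 1 with hG
    have hcoef : HasCoefficients ((newHom g 0)⁻¹ • e 0) (affineCoords g) F G := by
      refine ⟨(hFG 0).trans (congrArg _ ?_), (hFG 1).trans (congrArg _ ?_)⟩
      · simp only [hF, Fin.succ_zero_eq_one]
        ring
      · simp only [hG, Fin.succ_one_eq_two]
        ring
    have hrel : IsRelPrime F G := isRelPrime_of_isGenerator L g hcoef fun P hP =>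
      exists_isGenerator_of_degree_neg_one he htr g hP
    have hF0 : eval 0 F = 0 := by simp [hF]
    have hG0 : eval 0 G = 0 := by simp [hG]
    refine ⟨g, _, _, _, _, _, _, _, F, G, _, hequiv.smul_right (inv_ne_zero hg0), hcoef, hF, hG,
      ?_, ?_, hrel⟩
    -- If `F = 0`, coprimality makes `G` a unit, but `G` vanishes at the origin.
    · intro h
      rw [h, isRelPrime_zero_left] at hrel
      exact (hrel.map (eval 0)).ne_zero hG0
    · intro h
      rw [h, isRelPrime_zero_right] at hrel
      exact (hrel.map (eval 0)).ne_zero hF0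
  · have hMn := hMn hpos
    have hphi : ∀ i, frobForm M i = algebraMap k (FnField k) (M i 0) := by
      intro i
      have h00 : hom k 0 = 1 := rfl
      simp only [frobForm, Fin.sum_univ_three, (hMn i).1, (hMn i).2, h00, map_zero]
      ring
    -- A zero vector would make the generator zero.
    have hc : (fun i => M i 0) ≠ 0 := by
      intro h
      refine hgen.1 (eq_zero_of_hasCoefficients_zero 1 ?_)
      have hz : ∀ i, e 0 (hom k i) = 0 := fun i => by
        rw [hM, hphi, hphi, show M 0 0 = 0 from congrFun h 0, show M i 0 = 0 from congrFun h i]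
        simp
      rw [HasCoefficients, affineCoords_one, map_zero]
      exact ⟨hz 1, hz 2⟩
    obtain ⟨g, hg⟩ := exists_inv_col_eq hc
    have hg0 := newHom_ne_zero g 0
    have hψ : ∀ i, ∑ j, algebraMap k (FnField k) (g.1 i j) * frobForm M j =
        if i = 0 then 1 else 0 := by
      intro i
      simp only [hphi, ← map_mul, ← map_sum]
      have := sum_mul_inv_col g i
      simp only [hg] at this
      rw [this]
      split_ifs <;> simp
    -- In the new coordinates the field is induced by `∂_{X'₀}`, which sends `X'ᵢ / X'₀` to `X'ᵢ /
    -- X'₀²` up to a sign that is trivial here.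
    have happ : ∀ i : Fin 3, i ≠ 0 → (newHom g 0 • e 0) (newHom g i / newHom g 0) =
        newHom g i / newHom g 0 := by
      intro i hi
      rw [Derivation.smul_apply, apply_newHom_div hM, hψ, hψ, if_neg hi, if_pos rfl, smul_eq_mul]
      field_simp
      ring
    refine ⟨g, 0, 0, 0, 0, 1, 0, 0, X 0, X 1, newHom g 0 • e 0, hequiv.smul_right hg0, ?_,
      by simp, by simp, X_ne_zero _, X_ne_zero _, ?_⟩
    · refine ⟨?_, ?_⟩
      · rw [aeval_X]
        exact happ 1 (by decide)
      · rw [aeval_X]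
        exact happ 2 (by decide)
    · rw [(X_prime (i := (0 : Fin 2)) (R := k)).irreducible.isRelPrime_iff_not_dvd, X_dvd_X]
      decide
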